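/- Let $\mathbb H$ be the upper half-plane, and for $\gamma=\begin{pmatrix}a&b\\c&d\end{pmatrix}\in SL(2,\mathbb Q)$ and $f:\mathbb H\to\mathbb C$ of weight $k$ let $f|\gamma\,(z)=(cz+d)^{-k}f(\gamma z)$. **The cocycle $\widetilde{GV}$.** On monomials $fU_\gamma$ (with $\gamma\in SL(2,\mathbb Q)$ and $f$ of weight $w(f)$) set $$f^0U_\alpha\cdot f^1U_\beta=f^0\,(f^1|\alpha^{-1})\,U_{\alpha\beta},\qquad \delta_1(fU_\gamma)=\mu_{\gamma^{-1}}f\,U_\gamma,\qquad \mu_\gamma=\frac1{12\pi i}\frac{d}{dz}\log\frac{\Delta|\gamma}{\Delta},$$ where $\Delta=\eta^{24}$ has weight $12$ and $\mu_\gamma$ has weight $2$. For a modular form $f$ of some level let ${\bf a}_0(f)$ be its constant term at $\infty$ and $\widetilde f=f-{\bf a}_0(f)$. Fix $z_0\in\mathbb H$. If $\gamma_0\gamma_1=1$ and $w(f^0)+w(f^1)=2$, put, with $g=f^0\cdot f^1|\gamma_1$ and $h=f^0|\gamma_0\cdot f^1$, $$\widetilde\tau_0(f^0U_{\gamma_0},f^1U_{\gamma_1})=\int_{z_0}^{\gamma_0z_0}g\,dz+z_0\,{\bf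 a}_0(g-h)-\int_{z_0}^{i\infty}\widetilde{(g-h)}\,dz ,$$ and put $\widetilde\tau_0=0$ otherwise (the regularized modular symbol 1-trace). The regularized Godbillon–Vey cocycle is $$\widetilde{GV}(\gamma_1,\gamma_2)=\widetilde\tau_0\big(U_{\gamma_0}\,\delta_1(U_{\gamma_1}),\,U_{\gamma_2}\big),\qquad \gamma_0=(\gamma_1\gamma_2)^{-1}.$$ **The Petersson–Asai Euler cocycle.** For $g_1,g_2\in SL(2,\mathbb R)$, with $j(g,z)=cz+d$ and $\log$ the determination with imaginary part in $[-\pi,\pi)$, $$e(g_1,g_2)=\frac1{2\pi i}\big(\log j(g_2,z)+\log j(g_1,g_2z)-\log j(g_1g_2,z)\big),$$ where $z\in\mathbb H$ is arbitrary. **The extended Rademacher function.** Let ${\bf B}_1(x)=x-[x]-\tfrac12$, and $s(\tfrac mn)=\sum_{j=1}^{n-1}{\bf B}_1(\tfrac jn){\bf B}_1(\tfrac{mj}n)$ for coprime integers $m$, $n$ with $n\ge1$. For $\sigma=\begin{pmatrix}a&b\\c&d\end{pmatrix}\in SL(2,\mathbb Z)$ put $$\widetilde\Phi(\sigma)=\frac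 b{12d}+\frac{1-\operatorname{sign}(d)}4\ \ (c=0),\qquad \widetilde\Phi(\sigma)=\frac{a+d}{12c}-\operatorname{sign}(c)\Big(\frac14+s\big(\tfrac a{|c|}\big)\Big)\ \ (c\ne0).$$ Put $\widetilde\Phi(\beta)=\frac b{12d}+\frac{1-\operatorname{sign}(d)}4$ for upper triangular $\beta=\begin{pmatrix}a&b\\0&d\end{pmatrix}\in SL(2,\mathbb Q)$. In general, write $\gamma\in SL(2,\mathbb Q)$ as $\gamma=\sigma\beta$ with $\sigma\in SL(2,\mathbb Z)$ and $\beta\in SL(2,\mathbb Q)$ upper triangular with positive diagonal entries, and put $\widetilde\Phi(\gamma)=\widetilde\Phi(\sigma)+\widetilde\Phi(\beta)$; this is consistent and independent of the factorization. **Theorem.** For any choice of $z_0,z\in\mathbb H$, the function $\widetilde\Phi:SL(2,\mathbb Q)\to\mathbb Q$ satisfies $$\tfrac12\operatorname{Re}\widetilde{GV}(\gamma_1,\gamma_2)+e(\gamma_1,\gamma_2)=\widetilde\Phi(\gamma_1\gamma_2)-\widetilde\Phi(\gamma_1)-\widetilde\Phi(\gamma_2)\qquad\text{for all }\gamma_1,\gamma_2\in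 SL(2,\mathbb Q),$$ and it is the only function $SL(2,\mathbb Q)\to\mathbb R$ (in particular the only function $SL(2,\mathbb Q)\to\mathbb Q$) that does. -/

import Mathlib

open UpperHalfPlane ModularForm
open scoped MatrixGroups Real

noncomputable section

namespace Transgression

/-! ## Monomials of the modular crossed product -/

/-- The inclusion of `SL(2, ℚ)` in `GL(2, ℝ)`, through which `SL(2, ℚ)` acts on `ℍ` and, in
each weight, on functions on `ℍ`. -/
abbrev incl (γ : SL(2, ℚ)) : GL (Fin 2) ℝ := Matrix.SpecialLinearGroup.mapGL ℝ γ

/-- A monomial `f U_γ` of the crossed product of weighted functions on `ℍ` by `SL(2, ℚ)`. -/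
structure Monomial where
  weight : ℤ
  f : ℍ → ℂ
  γ : SL(2, ℚ)

/-- The convolution product `f⁰ U_α * f¹ U_β = f⁰ (f¹ | α⁻¹) U_{αβ}`. -/
def Monomial.mul (a b : Monomial) : Monomial where
  weight := a.weight + b.weight
  f := a.f * (b.f ∣[b.weight] incl a.γ⁻¹)
  γ := a.γ * b.γ

/-- The group-like monomial `U_γ`. -/
def U (γ : SL(2, ℚ)) : Monomial where
  weight := 0
  f := 1
  γ := γ

/-- The factor `μ_γ = (1 / 12πi) d/dz log (Δ|γ / Δ)`, a weight `2` modular form, where `Δ = η²⁴`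
is the modular discriminant. -/
def mu (γ : SL(2, ℚ)) (z : ℍ) : ℂ :=
  1 / (12 * π * Complex.I) *
    logDeriv (fun w : ℂ => (discriminant ∣[(12 : ℤ)] incl γ) (ofComplex w) /
      discriminant (ofComplex w)) (z : ℂ)

/-- The action of the Hopf algebra generator `δ₁`: `δ₁ (f U_γ^*) = μ_γ f U_γ^*` with
`U_γ^* = U_{γ⁻¹}`, that is, `δ₁ (f U_γ) = μ_{γ⁻¹} f U_γ`. -/
def delta1 (a : Monomial) : Monomial where
  weight := a.weight + 2
  f := mu a.γ⁻¹ * a.f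
  γ := a.γ

/-! ## The regularized modular symbol 1-trace -/

/-- The integral of `f dz` along the segment from `u` to `v` in `ℍ`. -/
def segIntegral (f : ℍ → ℂ) (u v : ℍ) : ℂ :=
  ∫ t in (0 : ℝ)..1, f (ofComplex ((u : ℂ) + t * ((v : ℂ) - u))) * ((v : ℂ) - u)

/-- The integral of `f dz` along the vertical half-line from `u` to `i∞`. -/
def cuspIntegral (f : ℍ → ℂ) (u : ℍ) : ℂ :=
  ∫ t in Set.Ioi (0 : ℝ), f (ofComplex ((u : ℂ) + t * Complex.I)) * Complex.I

/-- The constant term at `∞` of a modular form of some level: it is the limit of `f(z)` as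
`Im z → ∞`, which is the zeroth coefficient of the Fourier expansion of `f`. -/
def a0 (f : ℍ → ℂ) : ℂ := valueAtInfty f

/-- The remainder `f - a₀(f)`. -/
def remainder (f : ℍ → ℂ) : ℍ → ℂ := fun z => f z - a0 f

open Classical in
/-- The regularized modular symbol cochain `τ̃₀`, on monomials. It is supported on the pairs with
`w(f⁰) + w(f¹) = 2` and `γ₀ γ₁ = 1`. -/
def tauTilde (z₀ : ℍ) (a b : Monomial) : ℂ :=
  if a.weight + b.weight = 2 ∧ a.γ * b.γ = 1 then
    let g : ℍ → ℂ := a.f * (b.f ∣[b.weight] incl b.γ)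
    let h : ℍ → ℂ := (a.f ∣[a.weight] incl a.γ) * b.f
    segIntegral g z₀ (a.γ • z₀) + (z₀ : ℂ) * a0 (g - h) - cuspIntegral (remainder (g - h)) z₀
  else 0

/-- The cup product of `δ₁` with the 1-trace `τ̃₀`: `(a⁰, a¹, a²) ↦ τ̃₀ (a⁰ δ₁(a¹), a²)`. -/
def gvTilde (z₀ : ℍ) (a b c : Monomial) : ℂ := tauTilde z₀ (a.mul (delta1 b)) c

/-- The regularized Godbillon-Vey group cocycle: the restriction of the cup product to the group
algebra, `(γ₁, γ₂) ↦ τ̃₀ (U_{γ₀} δ₁(U_{γ₁}), U_{γ₂})` with `γ₀ γ₁ γ₂ = 1`. -/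
def GVTilde (z₀ : ℍ) (γ₁ γ₂ : SL(2, ℚ)) : ℂ :=
  gvTilde z₀ (U (γ₁ * γ₂)⁻¹) (U γ₁) (U γ₂)

/-! ## The Petersson-Asai cocycle -/

/-- The logarithm with imaginary part in `[-π, π)`. -/
def logLow (w : ℂ) : ℂ :=
  if Complex.arg w = π then Complex.log w - 2 * π * Complex.I else Complex.log w

/-- The cocycle `e` on `SL(2, ℝ)`, computed at the point `z ∈ ℍ`, where `denom g z = c z + d`. -/
def eulerCocycle (z : ℍ) (g₁ g₂ : SL(2, ℝ)) : ℂ :=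
  1 / (2 * π * Complex.I) *
    (logLow (denom g₂ z) + logLow (denom g₁ (g₂ • z : ℍ)) - logLow (denom (g₁ * g₂ : SL(2, ℝ)) z))

/-! ## The extended Rademacher function -/

/-- `B₁(x) = x - [x] - 1/2`. -/
def B1 (x : ℚ) : ℚ := Int.fract x - 1 / 2

/-- The Dedekind sum `s(m/n)`, for coprime `m` and `n ≥ 1`. -/
def dedekindSum (m : ℤ) (n : ℕ) : ℚ :=
  ∑ j ∈ Finset.Ico 1 n, B1 ((j : ℚ) / n) * B1 ((m : ℚ) * j / n)

/-- The (modified) Rademacher function on `SL(2, ℤ)`. -/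
def rademacherInt (σ : SL(2, ℤ)) : ℚ :=
  if σ 1 0 = 0 then (σ 0 1 : ℚ) / (12 * σ 1 1) + (1 - ((σ 1 1).sign : ℚ)) / 4
  else ((σ 0 0 : ℚ) + σ 1 1) / (12 * σ 1 0) -
    ((σ 1 0).sign : ℚ) * (1 / 4 + dedekindSum (σ 0 0) (σ 1 0).natAbs)

/-- The function on upper triangular rational matrices. -/
def rademacherBorel (β : SL(2, ℚ)) : ℚ :=
  β 0 1 / (12 * β 1 1) + (1 - (SignType.sign (β 1 1) : ℚ)) / 4

/-- The inclusion of `SL(2, ℤ)` in `SL(2, ℚ)`. -/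
abbrev ofInt : SL(2, ℤ) →* SL(2, ℚ) := Matrix.SpecialLinearGroup.map (Int.castRingHom ℚ)

/-- `β` is upper triangular with positive diagonal. -/
def IsPosBorel (β : SL(2, ℚ)) : Prop := β 1 0 = 0 ∧ 0 < β 1 1

theorem exists_factorization (γ : SL(2, ℚ)) :
    ∃ p : SL(2, ℤ) × SL(2, ℚ), γ = ofInt p.1 * p.2 ∧ IsPosBorel p.2 := by
  have hdet : γ 0 0 * γ 1 1 - γ 0 1 * γ 1 0 = 1 := by
    rw [← Matrix.det_fin_two]; exact γ.det_coe
  obtain ⟨p, q, r, hr, hpq, ha, hc⟩ : ∃ (p q : ℤ) (r : ℚ), 0 < r ∧ IsCoprime p q ∧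
      γ 0 0 = r * p ∧ γ 1 0 = r * q := by
    set a := γ 0 0
    set c := γ 1 0
    have hne : a.num * c.den ≠ 0 ∨ c.num * a.den ≠ 0 := by
      by_contra! h
      simp at h
      simp [h.1, h.2] at hdet
    obtain ⟨g, p, q, hg, hpq, h1, h2⟩ := Int.exists_gcd_one' (m := a.num * c.den)
      (n := c.num * a.den) (by rw [Int.gcd_pos_iff]; exact hne)
    refine ⟨p, q, (g : ℚ) / (a.den * c.den), by positivity,
      Int.isCoprime_iff_gcd_eq_one.mpr hpq, ?_, ?_⟩
    · have h1' : (a.num : ℚ) * c.den = p * g := by exact_mod_cast h1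
      have : (a.num : ℚ) = a * a.den := (Rat.mul_den_eq_num a).symm
      rw [this] at h1'
      have := a.den_pos
      have := c.den_pos
      field_simp
      linarith
    · have h1' : (c.num : ℚ) * a.den = q * g := by exact_mod_cast h2
      have : (c.num : ℚ) = c * c.den := (Rat.mul_den_eq_num c).symm
      rw [this] at h1'
      have := a.den_pos
      have := c.den_pos
      field_simp
      linarith
  obtain ⟨x, y, hxy⟩ := hpq
  have hxy' : (x : ℚ) * p + y * q = 1 := by exact_mod_cast hxy
  let τ : SL(2, ℤ) := ⟨!![x, y; -q, p], by rw [Matrix.det_fin_two_of]; linarith⟩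
  have t00 : τ 0 0 = x := rfl
  have t01 : τ 0 1 = y := rfl
  have t10 : τ 1 0 = -q := rfl
  have t11 : τ 1 1 = p := rfl
  have hβ10 : (ofInt τ * γ) 1 0 = 0 := by
    simp [t10, t11, Matrix.mul_apply, Fin.sum_univ_two, ha, hc]
    ring
  have hβ00 : (ofInt τ * γ) 0 0 = r := by
    simp [t00, t01, Matrix.mul_apply, Fin.sum_univ_two, ha, hc]
    linear_combination r * hxy'
  refine ⟨(τ⁻¹, ofInt τ * γ), by simp, hβ10, ?_⟩
  have hd := (ofInt τ * γ).det_coe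
  rw [Matrix.det_fin_two, hβ10, hβ00] at hd
  have : 0 < r * (ofInt τ * γ) 1 1 := by linarith
  exact (pos_iff_pos_of_mul_pos this).mp hr

/-- The extended Rademacher function `Φ̃` on `SL(2, ℚ)`: `Φ̃(σ β) = Φ̃(σ) + Φ̃(β)` for `σ` in
`SL(2, ℤ)` and `β` upper triangular with positive diagonal. The choice of the factorization does
not matter, by `rademacher_mul` below. -/
def rademacher (γ : SL(2, ℚ)) : ℚ :=
  rademacherInt (Classical.choose (exists_factorization γ)).1 +
    rademacherBorel (Classical.choose (exists_factorization γ)).2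

theorem factorization_unique (σ τ : SL(2, ℤ)) (β β' : SL(2, ℚ)) (hβ : IsPosBorel β)
    (hβ' : IsPosBorel β') (h : ofInt σ * β = ofInt τ * β') :
    rademacherInt σ + rademacherBorel β = rademacherInt τ + rademacherBorel β' := by
  obtain ⟨u, hu⟩ : ∃ u : SL(2, ℤ), τ = σ * u := ⟨σ⁻¹ * τ, by simp⟩
  subst hu
  have h1 : β = ofInt u * β' := by
    rw [map_mul, mul_assoc] at h
    exact mul_left_cancel h
  have e10 : (0 : ℚ) = u 1 0 * β' 0 0 := by
    rw [← hβ.1, h1]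
    simp [Matrix.mul_apply, Fin.sum_univ_two, hβ'.1]
  have e11 : β 1 1 = u 1 0 * β' 0 1 + u 1 1 * β' 1 1 := by
    rw [h1]; simp [Matrix.mul_apply, Fin.sum_univ_two]
  have e01 : β 0 1 = u 0 0 * β' 0 1 + u 0 1 * β' 1 1 := by
    rw [h1]; simp [Matrix.mul_apply, Fin.sum_univ_two]
  have d' := β'.det_coe
  rw [Matrix.det_fin_two, hβ'.1] at d'
  have hne : β' 0 0 ≠ 0 := by
    intro h0
    simp [h0] at d'
  have u10 : u 1 0 = 0 := by
    have := e10.symm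
    simp [hne] at this
    exact this
  have du := u.det_coe
  rw [Matrix.det_fin_two, u10, mul_zero, sub_zero] at du
  rw [u10, Int.cast_zero, zero_mul, zero_add] at e11
  have u11 : (0 : ℤ) < u 1 1 := by
    have h2 := hβ.2
    rw [e11] at h2
    exact_mod_cast (pos_iff_pos_of_mul_pos h2).mpr hβ'.2
  have u11' : u 1 1 = 1 := by
    rcases Int.eq_one_or_neg_one_of_mul_eq_one' du with h | h <;> omega
  have u00 : u 0 0 = 1 := by rw [u11'] at du; omega
  rw [u11', Int.cast_one, one_mul] at e11
  rw [u00, Int.cast_one, one_mul] at e01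
  have p' := hβ'.2
  have hB : rademacherBorel β = rademacherBorel β' + (u 0 1 : ℚ) / 12 := by
    simp only [rademacherBorel, e11, e01]
    field_simp
    ring
  have s00 : (σ * u) 0 0 = σ 0 0 := by
    simp [Matrix.mul_apply, Fin.sum_univ_two, u00, u10]
  have s01 : (σ * u) 0 1 = σ 0 0 * u 0 1 + σ 0 1 := by
    simp [Matrix.mul_apply, Fin.sum_univ_two, u11']
  have s10 : (σ * u) 1 0 = σ 1 0 := by
    simp [Matrix.mul_apply, Fin.sum_univ_two, u00, u10]
  have s11 : (σ * u) 1 1 = σ 1 0 * u 0 1 + σ 1 1 := by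
    simp [Matrix.mul_apply, Fin.sum_univ_two, u11']
  have hI : rademacherInt (σ * u) = rademacherInt σ + (u 0 1 : ℚ) / 12 := by
    have ds := σ.det_coe
    rw [Matrix.det_fin_two] at ds
    simp only [rademacherInt, s00, s01, s10, s11]
    split_ifs with hc
    · rw [hc, mul_zero, sub_zero] at ds
      rw [hc, zero_mul, zero_add]
      rcases Int.eq_one_or_neg_one_of_mul_eq_one' ds with h | h
      · rw [h.1, h.2]; push_cast; ring
      · rw [h.1, h.2]; push_cast; ring
    · have hc' : (σ 1 0 : ℚ) ≠ 0 := by exact_mod_cast hc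
      push_cast
      field_simp
      ring
  rw [hB, hI]
  ring

theorem rademacher_mul (σ : SL(2, ℤ)) (β : SL(2, ℚ)) (hβ : IsPosBorel β) :
    rademacher (ofInt σ * β) = rademacherInt σ + rademacherBorel β := by
  obtain ⟨h1, h2⟩ := Classical.choose_spec (exists_factorization (ofInt σ * β))
  exact factorization_unique _ _ _ _ h2 hβ h1.symm

theorem rademacher_ofInt (σ : SL(2, ℤ)) : rademacher (ofInt σ) = rademacherInt σ := by
  have := rademacher_mul σ 1 ⟨by simp, by simp⟩
  simpa [rademacherBorel] using this

theorem rademacher_borel (β : SL(2, ℚ)) (hβ : β 1 0 = 0) :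
    rademacher β = rademacherBorel β := by
  have hd := β.det_coe
  rw [Matrix.det_fin_two, hβ] at hd
  have hne : β 1 1 ≠ 0 := by
    intro h0
    simp [h0] at hd
  rcases lt_or_gt_of_ne hne with h | h
  · have := rademacher_mul (-1) (-β) ⟨by simp [hβ], by simpa using h⟩
    have e : ofInt (-1) * (-β) = β := by
      ext i j
      simp [ofInt]
    rw [e] at this
    rw [this]
    simp [rademacherInt, rademacherBorel, h]
    ring
  · have := rademacher_mul 1 β ⟨hβ, h⟩
    simpa [rademacherInt] using this

end Transgression

end

open UpperHalfPlane ModularForm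
open scoped MatrixGroups Real

noncomputable section

namespace Transgression

/-! Everything is read off from one primitive of `mu γ`. Fix the holomorphic logarithm `discLog` of
Δ on ℍ and let `muPrim γ` be (1/12πi)(log Δ(γz) − 12 log j(γ,z) − log Δ(z)). The logarithms of Δ
cancel in its coboundary, which is therefore twice the Euler cocycle (`muPrim_mul`); differentiating
gives the cocycle relation `mu_slash`.

On SL(2,ℤ) the form `mu` vanishes, so `muPrim` is constant. It equals 2Φ̃ because both change in the
same way under left multiplication by S and T; for S this is Dedekind reciprocity (`muPrim_ofInt`).
Writing γ = σβ, it follows that near i∞ `muPrim γ` is 2Φ̃(γ), plus an imaginary constant, plus a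
multiple of z, plus an exponentially small term (`exists_muPrim_eq`). Thus 2Φ̃(γ) is the real part
of the regularized value of `muPrim γ` at the cusp.

By the cocycle relation, the integrands of the regularized Godbillon–Vey cocycle are combinations of
`mu γ₁`, `mu γ₂` and `mu (γ₁ * γ₂)`. Evaluating the integrals by primitives, the base point
disappears: the cusp contributes the coboundary of 2Φ̃ and the segment contributes −2e, up to an
imaginary constant (`exists_GVTilde_eq`).

Uniqueness holds because two solutions differ by an additive character of SL(2,ℚ), and every such
real character is zero (`eq_zero_of_map_mul`). -/

/-! ### Dedekind sums and the reciprocity law -/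

/-- Multiplication by a unit permutes the nonzero residues. -/
theorem sum_mul_mod {M : Type*} [AddCommMonoid M] (f : ℕ → M) {h k : ℕ} (hhk : h.Coprime k) :
    ∑ j ∈ Finset.Ico 1 k, f (h * j % k) = ∑ j ∈ Finset.Ico 1 k, f j := by
  have maps : ∀ j ∈ Finset.Ico 1 k, h * j % k ∈ Finset.Ico 1 k := by
    intro j hj
    rw [Finset.mem_Ico] at hj ⊢
    refine ⟨Nat.one_le_iff_ne_zero.mpr fun h0 => ?_, Nat.mod_lt _ (by omega)⟩
    have := hhk.symm.dvd_of_dvd_mul_left (Nat.dvd_of_mod_eq_zero h0)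
    have := Nat.le_of_dvd (by omega) this
    omega
  have inj : Set.InjOn (fun j => h * j % k) (Finset.Ico 1 k : Finset ℕ) := by
    intro i hi j hj hij
    simp only [Finset.coe_Ico, Set.mem_Ico] at hi hj
    have : i ≡ j [MOD k] := Nat.ModEq.cancel_left_of_coprime (by simpa using hhk.symm) hij
    rwa [Nat.ModEq, Nat.mod_eq_of_lt hi.2, Nat.mod_eq_of_lt hj.2] at this
  exact Finset.sum_nbij _ maps inj (Finset.surjOn_of_injOn_of_card_le _ maps inj le_rfl)
    fun _ _ => rfl

theorem sum_Ico_cast (n : ℕ) : ∑ j ∈ Finset.Ico 1 (n + 1), (j : ℚ) = n * (n + 1) / 2 := by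
  induction n with
  | zero => simp
  | succ n ih => rw [Finset.sum_Ico_succ_top (by omega), ih]; push_cast; ring

theorem sum_Ico_cast_sq (n : ℕ) :
    ∑ j ∈ Finset.Ico 1 (n + 1), (j : ℚ) ^ 2 = n * (n + 1) * (2 * n + 1) / 6 := by
  induction n with
  | zero => simp
  | succ n ih => rw [Finset.sum_Ico_succ_top (by omega), ih]; push_cast; ring

/-- Counting lattice points below the diagonal of an `h × k` rectangle, with weights. -/
theorem sum_div_mul_div_add_one {h k : ℕ} (hh : 0 < h) (hhk : h.Coprime k) :
    ∑ j ∈ Finset.Ico 1 k, ((h * j / k : ℕ) : ℚ) * ((h * j / k : ℕ) + 1) =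
      ∑ i ∈ Finset.Ico 1 h, 2 * (i : ℚ) * (k - 1 - (k * i / h : ℕ)) := by
  have key : ∀ j ∈ Finset.Ico 1 k, ∀ i ∈ Finset.Ico 1 h,
      (i ≤ h * j / k ↔ k * i / h < j) := by
    intro j hj i hi
    rw [Finset.mem_Ico] at hj hi
    rw [Nat.le_div_iff_mul_le (by omega), Nat.div_lt_iff_lt_mul hh]
    -- By coprimality no lattice point lies on the diagonal, so strict and weak inequalities agree.
    have hne : k * i ≠ h * j := by
      intro he
      have := hhk.dvd_of_dvd_mul_left (Dvd.intro _ he.symm)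
      have := Nat.le_of_dvd (by omega) this
      omega
    rw [mul_comm i k, mul_comm j h]
    omega
  -- Since m(m+1) is the sum of 2i for 1 ≤ i ≤ m, each column is a count with weight 2i; then
  -- columns and rows are exchanged.
  calc _ = ∑ j ∈ Finset.Ico 1 k, ∑ i ∈ Finset.Ico 1 h,
        if i ≤ h * j / k then 2 * (i : ℚ) else 0 := by
        refine Finset.sum_congr rfl fun j hj => ?_
        rw [Finset.mem_Ico] at hj
        have hlt : h * j / k < h := by
          rw [Nat.div_lt_iff_lt_mul (by omega)]
          exact Nat.mul_lt_mul_of_pos_left hj.2 hh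
        rw [← Finset.sum_filter]
        have : (Finset.Ico 1 h).filter (fun i => i ≤ h * j / k) =
            Finset.Ico 1 (h * j / k + 1) := by
          ext i; simp only [Finset.mem_filter, Finset.mem_Ico]; omega
        rw [this, ← Finset.mul_sum, sum_Ico_cast]
        ring
    _ = ∑ i ∈ Finset.Ico 1 h, ∑ j ∈ Finset.Ico 1 k,
        if i ≤ h * j / k then 2 * (i : ℚ) else 0 := Finset.sum_comm
    _ = _ := by
        refine Finset.sum_congr rfl fun i hi => ?_
        have : ∀ j ∈ Finset.Ico 1 k, (if i ≤ h * j / k then 2 * (i : ℚ) else 0) =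
            if k * i / h < j then 2 * (i : ℚ) else 0 := by
          intro j hj
          simp only [key j hj i hi]
        rw [Finset.sum_congr rfl this, ← Finset.sum_filter]
        rw [Finset.mem_Ico] at hi
        have e : (Finset.Ico 1 k).filter (fun j => k * i / h < j) =
            Finset.Ico (k * i / h + 1) k := by
          generalize k * i / h = m
          ext j; simp only [Finset.mem_filter, Finset.mem_Ico]; omega
        rw [e, Finset.sum_const, Nat.card_Ico, nsmul_eq_mul]
        rcases Nat.eq_zero_or_pos k with rfl | hk
        · have : h = 1 := by simpa using hhk
          omega
        have hlt : k * i / h < k := by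
          rw [Nat.div_lt_iff_lt_mul hh]
          exact Nat.mul_lt_mul_of_pos_left hi.2 hk
        rw [Nat.cast_sub (Nat.succ_le_of_lt hlt)]
        push_cast
        ring

theorem B1_natCast_mul_div (m j n : ℕ) (hn : n ≠ 0) :
    B1 (((m : ℤ) : ℚ) * j / n) = (m : ℚ) * j / n - (m * j / n : ℕ) - 1 / 2 := by
  have h1 : ((m : ℤ) : ℚ) * j / n = ((m * j : ℕ) : ℚ) / n := by push_cast; rfl
  have h2 : ((m * j % n : ℕ) : ℚ) + n * (m * j / n : ℕ) = (m * j : ℕ) := by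
    exact_mod_cast Nat.mod_add_div (m * j) n
  have hn' : (n : ℚ) ≠ 0 := by exact_mod_cast hn
  rw [B1, h1, Int.fract_div_natCast_eq_div_natCast_mod]
  push_cast at h2 ⊢
  field_simp
  linarith

theorem natCast_mod_eq (m k : ℕ) : ((m % k : ℕ) : ℚ) = m - k * (m / k : ℕ) := by
  rw [eq_sub_iff_add_eq]
  exact_mod_cast Nat.mod_add_div m k

/-- Sum the divisions with remainder of h·j by k: the remainders are again 1, …, k − 1. -/
theorem sum_div_of_coprime {h k : ℕ} (hhk : h.Coprime k) (hk : 0 < k) :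
    ∑ j ∈ Finset.Ico 1 k, ((h * j / k : ℕ) : ℚ) = (h - 1) * (k - 1) / 2 := by
  obtain ⟨n, rfl⟩ : ∃ n, k = n + 1 := ⟨k - 1, by omega⟩
  have hk' : ((n + 1 : ℕ) : ℚ) ≠ 0 := by positivity
  have hmod := sum_mul_mod (fun j => (j : ℚ)) hhk
  simp only [natCast_mod_eq, Nat.cast_mul, Finset.sum_sub_distrib, ← Finset.mul_sum,
    sum_Ico_cast] at hmod
  apply mul_left_cancel₀ hk'
  push_cast at hmod ⊢
  linarith

/-- Expanding the product of the `B1`, every term but one sums in closed form; reciprocity becomes a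
relation between the remaining sums for (h, k) and (k, h). -/
theorem dedekindSum_natCast_eq {h k : ℕ} (hk : 0 < k) (hhk : h.Coprime k) :
    12 * k * dedekindSum h k = 2 * h * (k - 1) * (2 * k - 1) - 3 * k * (k - 1) -
      12 * ∑ j ∈ Finset.Ico 1 k, (j : ℚ) * (h * j / k : ℕ) := by
  obtain ⟨n, rfl⟩ : ∃ n, k = n + 1 := ⟨k - 1, by omega⟩
  have hk' : ((n + 1 : ℕ) : ℚ) ≠ 0 := by positivity
  have hsum := sum_div_of_coprime hhk n.succ_pos
  rw [Nat.cast_succ, add_sub_cancel_right] at hsum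
  have hterm : ∀ j ∈ Finset.Ico 1 (n + 1),
      B1 ((j : ℚ) / (n + 1 : ℕ)) * B1 (((h : ℤ) : ℚ) * j / (n + 1 : ℕ)) =
        h / (n + 1 : ℕ) ^ 2 * (j : ℚ) ^ 2 - 1 / (n + 1 : ℕ) * ((j : ℚ) * (h * j / (n + 1) : ℕ))
        - (1 + h) / (2 * (n + 1 : ℕ)) * j + 1 / 2 * (h * j / (n + 1) : ℕ) + 1 / 4 := by
    intro j hj
    rw [Finset.mem_Ico] at hj
    have h1 := B1_natCast_mul_div 1 j (n + 1) (by omega)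
    rw [one_mul, Nat.div_eq_of_lt hj.2] at h1
    rw [B1_natCast_mul_div h j (n + 1) (by omega)]
    have h1' : B1 ((j : ℚ) / (n + 1 : ℕ)) = j / (n + 1 : ℕ) - 1 / 2 := by
      simpa using h1
    rw [h1']
    field_simp
    ring
  rw [dedekindSum, Finset.sum_congr rfl hterm]
  simp only [Finset.sum_add_distrib, Finset.sum_sub_distrib, ← Finset.mul_sum, sum_Ico_cast,
    sum_Ico_cast_sq, hsum, Finset.sum_const, Nat.card_Ico, nsmul_eq_mul]
  set T := ∑ j ∈ Finset.Ico 1 (n + 1), (j : ℚ) * (h * j / (n + 1) : ℕ)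
  push_cast at hk' ⊢
  field_simp
  ring

/-- Dedekind's reciprocity law. -/
theorem dedekindSum_reciprocity {h k : ℕ} (hh : 0 < h) (hk : 0 < k) (hhk : h.Coprime k) :
    dedekindSum h k + dedekindSum k h =
      -1 / 4 + ((h : ℚ) / k + k / h + 1 / (h * k)) / 12 := by
  have hk' : (k : ℚ) ≠ 0 := by positivity
  have hh' : (h : ℚ) ≠ 0 := by positivity
  have e1 := dedekindSum_natCast_eq hk hhk
  have e2 := dedekindSum_natCast_eq hh hhk.symm
  have e3 := sum_div_mul_div_add_one hh hhk
  have e4 := sum_mul_mod (fun j => (j : ℚ) ^ 2) hhk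
  have e5 := sum_div_of_coprime hhk hk
  -- The squares of the remainders have the same sum as the j². Expanding them with the quotient q
  -- grouped as q(q+1) lets the lattice point count replace that part by the sum for (k, h).
  have hmod : ∀ j, ((h * j % k : ℕ) : ℚ) ^ 2 =
      h ^ 2 * (j : ℚ) ^ 2 - 2 * h * k * (j * (h * j / k : ℕ)) +
        k ^ 2 * ((h * j / k : ℕ) * ((h * j / k : ℕ) + 1)) - k ^ 2 * (h * j / k : ℕ) := by
    intro j
    rw [natCast_mod_eq, Nat.cast_mul]
    ring
  obtain ⟨m, rfl⟩ : ∃ m, h = m + 1 := ⟨h - 1, by omega⟩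
  obtain ⟨n, rfl⟩ : ∃ n, k = n + 1 := ⟨k - 1, by omega⟩
  simp only [hmod, Finset.sum_add_distrib, Finset.sum_sub_distrib, ← Finset.mul_sum, e5, e3,
    sum_Ico_cast_sq] at e4
  have e6 : ∀ i : ℕ, 2 * (i : ℚ) * ((n + 1 : ℕ) - 1 - ((n + 1) * i / (m + 1) : ℕ)) =
      2 * n * i - 2 * ((i : ℚ) * ((n + 1) * i / (m + 1) : ℕ)) := by
    intro i; push_cast; ring
  simp only [e6, Finset.sum_sub_distrib, ← Finset.mul_sum, sum_Ico_cast] at e4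
  set A := ∑ j ∈ Finset.Ico 1 (n + 1), (j : ℚ) * ((m + 1) * j / (n + 1) : ℕ)
  set B := ∑ j ∈ Finset.Ico 1 (m + 1), (j : ℚ) * ((n + 1) * j / (m + 1) : ℕ)
  have hS : dedekindSum (m + 1 : ℕ) (n + 1) = _ := eq_div_of_mul_eq (by positivity)
    ((mul_comm _ _).trans e1)
  have hS' : dedekindSum (n + 1 : ℕ) (m + 1) = _ := eq_div_of_mul_eq (by positivity)
    ((mul_comm _ _).trans e2)
  rw [hS, hS']
  push_cast at *
  field_simp
  apply mul_left_cancel₀ hk'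
  linear_combination 24 * e4

theorem B1_neg {x : ℚ} (hx : Int.fract x ≠ 0) : B1 (-x) = -B1 x := by
  rw [B1, B1, Int.fract_neg hx]
  ring

/-- `B1` is odd only off the integers, where it takes the value −1/2; coprimality keeps m·j/n away
from them. -/
theorem dedekindSum_neg {m : ℤ} {n : ℕ} (h : m.gcd n = 1) :
    dedekindSum (-m) n = -dedekindSum m n := by
  rw [dedekindSum, dedekindSum, ← Finset.sum_neg_distrib]
  refine Finset.sum_congr rfl fun j hj => ?_
  rw [Finset.mem_Ico] at hj
  have hn : (n : ℚ) ≠ 0 := by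
    have : n ≠ 0 := by omega
    exact_mod_cast this
  rw [Int.cast_neg, neg_mul, neg_div, B1_neg, mul_neg]
  intro h0
  rw [Int.fract_eq_iff] at h0
  obtain ⟨z, hz⟩ := h0.2.2
  rw [sub_zero, div_eq_iff hn] at hz
  have hz' : m * j = z * n := by exact_mod_cast hz
  have hdvd : (n : ℤ) ∣ m * j := Dvd.intro_left _ hz'.symm
  have : (n : ℤ) ∣ j := (Int.isCoprime_iff_gcd_eq_one.mpr h).symm.dvd_of_dvd_mul_left hdvd
  have := Nat.le_of_dvd (by omega) (Int.natCast_dvd_natCast.mp this)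
  omega

theorem dedekindSum_natAbs {m : ℤ} {n : ℕ} (h : m.gcd n = 1) :
    dedekindSum m n = m.sign * dedekindSum m.natAbs n := by
  rcases lt_trichotomy m 0 with hm | rfl | hm
  · rw [Int.sign_eq_neg_one_of_neg hm]
    obtain ⟨k, rfl⟩ : ∃ k : ℕ, m = -k := ⟨m.natAbs, by omega⟩
    rw [dedekindSum_neg (by simpa using h), Int.natAbs_neg, Int.natAbs_natCast]
    simp
  · have : n = 1 := by simpa using h
    subst this
    simp [dedekindSum]
  · rw [Int.sign_eq_one_of_pos hm]
    obtain ⟨k, rfl⟩ : ∃ k : ℕ, m = k := ⟨m.natAbs, by omega⟩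
    simp

/-- The reciprocity law for arguments of arbitrary signs. -/
theorem dedekindSum_reciprocity_sign {a c : ℤ} (ha : a ≠ 0) (hc : c ≠ 0) (h : a.gcd c = 1) :
    (c.sign : ℚ) * dedekindSum a c.natAbs + a.sign * dedekindSum c a.natAbs =
      -((a.sign : ℚ) * c.sign) / 4 + ((a : ℚ) / c + c / a + 1 / (a * c)) / 12 := by
  have key := dedekindSum_reciprocity (h := a.natAbs) (k := c.natAbs) (by omega) (by omega) h
  rw [dedekindSum_natAbs (m := a) (by simpa [Int.gcd, Int.natAbs_abs] using h), dedekindSum_natAbs (m := c)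
    (by simpa [Int.gcd, Int.natAbs_abs, Nat.gcd_comm] using h)]
  have ea : (a.natAbs : ℚ) = a.sign * a := by
    rw [← Int.cast_natCast, ← Int.sign_mul_self_eq_natAbs, Int.cast_mul]
  have ec : (c.natAbs : ℚ) = c.sign * c := by
    rw [← Int.cast_natCast, ← Int.sign_mul_self_eq_natAbs, Int.cast_mul]
  rw [ea, ec] at key
  have ha' : (a : ℚ) ≠ 0 := by exact_mod_cast ha
  have hc' : (c : ℚ) ≠ 0 := by exact_mod_cast hc
  have hsa : (a.sign : ℚ) = 1 ∨ (a.sign : ℚ) = -1 := by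
    rcases ha.lt_or_gt with h | h
    · simp [Int.sign_eq_neg_one_of_neg h]
    · simp [Int.sign_eq_one_of_pos h]
  have hsc : (c.sign : ℚ) = 1 ∨ (c.sign : ℚ) = -1 := by
    rcases hc.lt_or_gt with h | h
    · simp [Int.sign_eq_neg_one_of_neg h]
    · simp [Int.sign_eq_one_of_pos h]
  rcases hsa with h1 | h1 <;> rcases hsc with h2 | h2 <;> rw [h1, h2] at key ⊢ <;>
    field_simp at key ⊢ <;> linarith

/-! ### The Rademacher function under left multiplication by S and T -/

/-- Reciprocity cancels the Dedekind sums against the rational terms, leaving only signs; these are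
matched with arguments of logarithms in `eulerCocycle_S`. -/
theorem rademacherInt_S_mul {σ : SL(2, ℤ)} (ha : σ 0 0 ≠ 0) (hc : σ 1 0 ≠ 0) :
    rademacherInt (ModularGroup.S * σ) - rademacherInt σ =
      (-((σ 0 0).sign : ℚ) * (σ 1 0).sign - (σ 0 0).sign + (σ 1 0).sign) / 4 := by
  have s00 : (ModularGroup.S * σ) 0 0 = -σ 1 0 := by
    simp [Matrix.SpecialLinearGroup.coe_mul, ModularGroup.coe_S, Matrix.mul_apply, Fin.sum_univ_two]
  have s01 : (ModularGroup.S * σ) 0 1 = -σ 1 1 := by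
    simp [Matrix.SpecialLinearGroup.coe_mul, ModularGroup.coe_S, Matrix.mul_apply, Fin.sum_univ_two]
  have s10 : (ModularGroup.S * σ) 1 0 = σ 0 0 := by
    simp [Matrix.SpecialLinearGroup.coe_mul, ModularGroup.coe_S, Matrix.mul_apply, Fin.sum_univ_two]
  have s11 : (ModularGroup.S * σ) 1 1 = σ 0 1 := by
    simp [Matrix.SpecialLinearGroup.coe_mul, ModularGroup.coe_S, Matrix.mul_apply, Fin.sum_univ_two]
  have hd := σ.det_coe
  rw [Matrix.det_fin_two] at hd
  have hcop : IsCoprime (σ 0 0) (σ 1 0) := ⟨σ 1 1, -σ 0 1, by linarith⟩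
  have hg := Int.isCoprime_iff_gcd_eq_one.mp hcop
  have key := dedekindSum_reciprocity_sign ha hc hg
  simp only [rademacherInt, s00, s10, s11, if_neg ha, if_neg hc]
  rw [dedekindSum_neg (by simpa [Int.gcd, Int.natAbs_abs, Nat.gcd_comm] using hg)]
  have ha' : (σ 0 0 : ℚ) ≠ 0 := by exact_mod_cast ha
  have hc' : (σ 1 0 : ℚ) ≠ 0 := by exact_mod_cast hc
  have hd' : (σ 0 1 : ℚ) = (σ 0 0 * σ 1 1 - 1) / σ 1 0 := by
    field_simp
    have : (σ 0 0 : ℚ) * σ 1 1 - σ 0 1 * σ 1 0 = 1 := by exact_mod_cast hd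
    linarith
  rw [hd']
  push_cast
  have e : ((-(σ 1 0 : ℚ)) + (σ 0 0 * σ 1 1 - 1) / σ 1 0) / (12 * σ 0 0) -
      ((σ 0 0 : ℚ) + σ 1 1) / (12 * σ 1 0) =
        -((σ 0 0 : ℚ) / σ 1 0 + σ 1 0 / σ 0 0 + 1 / (σ 0 0 * σ 1 0)) / 12 := by
    field_simp
    ring
  linear_combination e + key

/-- The Dedekind sum sees `σ 0 0` only modulo `σ 1 0`, so only the rational term moves. -/
theorem rademacherInt_T_mul (σ : SL(2, ℤ)) :
    rademacherInt (ModularGroup.T * σ) = rademacherInt σ + 1 / 12 := by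
  have s00 : (ModularGroup.T * σ) 0 0 = σ 0 0 + σ 1 0 := by
    simp [Matrix.SpecialLinearGroup.coe_mul, ModularGroup.coe_T, Matrix.mul_apply, Fin.sum_univ_two]
  have s01 : (ModularGroup.T * σ) 0 1 = σ 0 1 + σ 1 1 := by
    simp [Matrix.SpecialLinearGroup.coe_mul, ModularGroup.coe_T, Matrix.mul_apply, Fin.sum_univ_two]
  have s10 : (ModularGroup.T * σ) 1 0 = σ 1 0 := by
    simp
  have s11 : (ModularGroup.T * σ) 1 1 = σ 1 1 := by
    simp
  have hd := σ.det_coe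
  rw [Matrix.det_fin_two] at hd
  simp only [rademacherInt, s00, s01, s10, s11]
  split_ifs with hc
  · have : (σ 1 1 : ℚ) ≠ 0 := by
      intro h0
      have : σ 1 1 = 0 := by exact_mod_cast h0
      simp [this, hc] at hd
    push_cast
    field_simp
    ring
  · have hc' : (σ 1 0 : ℚ) ≠ 0 := by exact_mod_cast hc
    have hs : dedekindSum (σ 0 0 + σ 1 0) (σ 1 0).natAbs =
        dedekindSum (σ 0 0) (σ 1 0).natAbs := by
      refine Finset.sum_congr rfl fun j _ => ?_
      obtain ⟨e, he⟩ : ∃ e : ℤ, σ 1 0 = e * ((σ 1 0).natAbs : ℤ) :=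
        ⟨(σ 1 0).sign, (Int.sign_mul_natAbs _).symm⟩
      have hn : ((σ 1 0).natAbs : ℚ) ≠ 0 := by simpa using hc
      have he' : (σ 1 0 : ℚ) = e * ((σ 1 0).natAbs : ℚ) := by
        rw [← Int.cast_natCast, ← Int.cast_mul, ← he]
      have : ((σ 0 0 + σ 1 0 : ℤ) : ℚ) * j / (σ 1 0).natAbs =
          (σ 0 0 : ℚ) * j / (σ 1 0).natAbs + (e * j : ℤ) := by
        push_cast
        rw [he']
        field_simp
      rw [this, B1, B1, Int.fract_add_intCast, B1]
    rw [hs]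
    push_cast
    field_simp
    ring

/-! ### Unipotent matrices and additive characters -/

/-- The upper unipotent matrix with entry `x`. -/
def upperUnip (x : ℚ) : SL(2, ℚ) := ⟨!![1, x; 0, 1], by simp⟩

/-- The lower unipotent matrix with entry `x`. -/
def lowerUnip (x : ℚ) : SL(2, ℚ) := ⟨!![1, 0; x, 1], by simp⟩

theorem coe_upperUnip (x : ℚ) : (upperUnip x : Matrix (Fin 2) (Fin 2) ℚ) = !![1, x; 0, 1] :=
  rfl

theorem coe_lowerUnip (x : ℚ) : (lowerUnip x : Matrix (Fin 2) (Fin 2) ℚ) = !![1, 0; x, 1] :=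
  rfl

theorem upperUnip_mul (x y : ℚ) : upperUnip x * upperUnip y = upperUnip (x + y) := by
  ext i j
  fin_cases i <;> fin_cases j <;>
    simp [coe_upperUnip, Matrix.SpecialLinearGroup.coe_mul, Matrix.mul_apply,
        Fin.sum_univ_two, add_comm]

theorem lowerUnip_mul (x y : ℚ) : lowerUnip x * lowerUnip y = lowerUnip (x + y) := by
  ext i j
  fin_cases i <;> fin_cases j <;>
    simp [coe_lowerUnip, Matrix.SpecialLinearGroup.coe_mul, Matrix.mul_apply,
        Fin.sum_univ_two]

theorem eq_unip_mul {γ : SL(2, ℚ)} (hc : γ 1 0 ≠ 0) :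
    γ = upperUnip ((γ 0 0 - 1) / γ 1 0) * lowerUnip (γ 1 0) *
      upperUnip ((γ 1 1 - 1) / γ 1 0) := by
  have hd := γ.det_coe
  rw [Matrix.det_fin_two] at hd
  have hb : γ 0 1 = (γ 0 0 * γ 1 1 - 1) / γ 1 0 := by
    field_simp
    linarith
  ext i j
  fin_cases i <;> fin_cases j <;>
    simp [coe_upperUnip, coe_lowerUnip, Matrix.SpecialLinearGroup.coe_mul, Matrix.mul_apply,
        Fin.sum_univ_two, hb] <;> field_simp <;> ring

/-- `SL(2, ℚ)` has no nonzero additive characters. -/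
theorem eq_zero_of_map_mul {f : SL(2, ℚ) → ℝ} (hf : ∀ x y, f (x * y) = f x + f y)
    (γ : SL(2, ℚ)) : f γ = 0 := by
  -- Conjugation by `D` multiplies the entry of an upper unipotent by 4, and its inverse does so for
  -- lower ones, so f = 4f on unipotents.
  let D : SL(2, ℚ) := ⟨!![2, 0; 0, 1 / 2], by simp⟩
  have hD : (D : Matrix (Fin 2) (Fin 2) ℚ) = !![2, 0; 0, 1 / 2] := rfl
  have hU : ∀ x, f (upperUnip x) = 0 := by
    intro x
    have e : D * upperUnip x = upperUnip (x + x + (x + x)) * D := by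
      ext i j
      fin_cases i <;> fin_cases j <;>
        simp [hD, coe_upperUnip, Matrix.SpecialLinearGroup.coe_mul, Matrix.mul_apply,
        Fin.sum_univ_two]
      ring
    have := congrArg f e
    rw [← upperUnip_mul, ← upperUnip_mul] at this
    simp only [hf] at this
    linarith
  have hL : ∀ x, f (lowerUnip x) = 0 := by
    intro x
    have e : lowerUnip x * D = D * lowerUnip (x + x + (x + x)) := by
      ext i j
      fin_cases i <;> fin_cases j <;>
        simp [hD, coe_lowerUnip, Matrix.SpecialLinearGroup.coe_mul, Matrix.mul_apply,
        Fin.sum_univ_two]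
      ring
    have := congrArg f e
    rw [← lowerUnip_mul, ← lowerUnip_mul] at this
    simp only [hf] at this
    linarith
  have hne : ∀ γ : SL(2, ℚ), γ 1 0 ≠ 0 → f γ = 0 := by
    intro γ hc
    rw [eq_unip_mul hc]
    simp [hf, hU, hL]
  by_cases hc : γ 1 0 = 0
  · have hd := γ.det_coe
    rw [Matrix.det_fin_two, hc] at hd
    -- An upper triangular γ is moved into the big cell, where the unipotent factorization applies:
    -- the lower left entry becomes `γ 0 0`, which is nonzero.
    have := hne (lowerUnip 1 * γ) (by
      simp [coe_lowerUnip, Matrix.SpecialLinearGroup.coe_mul, Matrix.mul_apply,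
        Fin.sum_univ_two, hc]
      intro h0
      simp [h0] at hd)
    rwa [hf, hL, zero_add] at this
  · exact hne γ hc

/-! ### A holomorphic logarithm of Δ and its behaviour at the cusp -/

/-- The Euler product `∏ (1 - qⁿ)` has a holomorphic logarithm on the unit disc. -/
theorem exists_log_eulerProduct : ∃ G : ℂ → ℂ, G 0 = 0 ∧
    (∀ q ∈ Metric.ball (0 : ℂ) 1, DifferentiableAt ℂ G q) ∧
    ∀ q ∈ Metric.ball (0 : ℂ) 1, Complex.exp (G q) = ∏' n : ℕ, (1 - q ^ (n + 1)) := by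
  set E : ℂ → ℂ := fun q => ∏' n : ℕ, (1 - q ^ (n + 1)) with hE
  have hdiff : DifferentiableOn ℂ E (Metric.ball 0 1) := differentiableOn_tprod_one_sub_pow
  have hne : ∀ q ∈ Metric.ball (0 : ℂ) 1, E q ≠ 0 := by
    intro q hq
    have hq' : ‖q‖ < 1 := by simpa using hq
    have hsum : Summable fun n : ℕ => ‖q‖ ^ (n + 1) :=
      (summable_nat_add_iff 1).mpr (summable_geometric_of_lt_one (norm_nonneg _) hq')
    have := tprod_one_add_ne_zero_of_summable (f := fun n : ℕ => -q ^ (n + 1)) (fun n h => by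
      have h1 : q ^ (n + 1) = 1 := by linear_combination -h
      have h2 := congrArg norm h1
      rw [norm_pow, norm_one] at h2
      exact (pow_lt_one₀ (norm_nonneg _) hq' n.succ_ne_zero).ne h2)
      (by simpa using hsum)
    simpa [hE, sub_eq_add_neg] using this
  -- The logarithm is the primitive of E′/E on the disc that vanishes at 0; E·exp(−G) then has zero
  -- derivative.
  obtain ⟨G, hG0, hG⟩ := ((hdiff.deriv Metric.isOpen_ball).div hdiff hne).isExactOn_ball.with_val_at
    0 0
  refine ⟨G, hG0, fun q hq => (hG q hq).differentiableAt, fun q hq => ?_⟩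
  have hd : ∀ x ∈ Metric.ball (0 : ℂ) 1,
      HasDerivAt (fun x => E x * Complex.exp (-G x)) 0 x := by
    intro x hx
    have h1 := (hdiff.differentiableAt (Metric.isOpen_ball.mem_nhds hx)).hasDerivAt
    have h2 := h1.mul (hG x hx).neg.cexp
    convert! h2 using 1
    have := hne x hx
    simp only [Pi.div_apply]
    field_simp
    simp
  have hc : E q * Complex.exp (-G q) = E 0 * Complex.exp (-G 0) :=
    Metric.isOpen_ball.is_const_of_deriv_eq_zero (convex_ball 0 1).isPreconnected
      (fun x hx => (hd x hx).differentiableAt.differentiableWithinAt)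
      (fun x hx => (hd x hx).deriv) hq (by simp)
  have hE0 : E 0 = 1 := by simp [hE]
  rw [hE0, hG0, neg_zero, Complex.exp_zero, mul_one, Complex.exp_neg] at hc
  have := Complex.exp_ne_zero (G q)
  field_simp at hc
  exact hc.symm

/-- The logarithm of the Euler product `∏ (1 - qⁿ)` which vanishes at `q = 0`. -/
def eulerLog : ℂ → ℂ := Classical.choose exists_log_eulerProduct

theorem eulerLog_zero : eulerLog 0 = 0 := (Classical.choose_spec exists_log_eulerProduct).1

theorem differentiableAt_eulerLog {q : ℂ} (hq : ‖q‖ < 1) : DifferentiableAt ℂ eulerLog q :=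
  (Classical.choose_spec exists_log_eulerProduct).2.1 q (by simpa using hq)

theorem exp_eulerLog {q : ℂ} (hq : ‖q‖ < 1) :
    Complex.exp (eulerLog q) = ∏' n : ℕ, (1 - q ^ (n + 1)) :=
  (Classical.choose_spec exists_log_eulerProduct).2.2 q (by simpa using hq)

theorem continuousAt_deriv_eulerLog {q : ℂ} (hq : ‖q‖ < 1) :
    ContinuousAt (deriv eulerLog) q := by
  have h : DifferentiableOn ℂ eulerLog (Metric.ball 0 1) := fun x hx =>
    (differentiableAt_eulerLog (by simpa using hx)).differentiableWithinAt
  exact ((h.deriv Metric.isOpen_ball).differentiableAt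
    (Metric.isOpen_ball.mem_nhds (by simpa using hq))).continuousAt

/-- The logarithm of `Δ(z) / q`. -/
def tailLog (w : ℂ) : ℂ := 24 * eulerLog (Function.Periodic.qParam 1 w)

/-- The derivative of `tailLog`. -/
def tailLogDeriv (w : ℂ) : ℂ :=
  24 * (deriv eulerLog (Function.Periodic.qParam 1 w) *
    (2 * π * Complex.I * Function.Periodic.qParam 1 w))

theorem norm_qParam_one (w : ℂ) :
    ‖Function.Periodic.qParam 1 w‖ = Real.exp (-2 * π * w.im) := by
  simpa using Function.Periodic.norm_qParam 1 w

theorem norm_qParam_one_lt_one {w : ℂ} (hw : 0 < w.im) :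
    ‖Function.Periodic.qParam 1 w‖ < 1 := by
  rw [norm_qParam_one, Real.exp_lt_one_iff]
  have := mul_pos Real.pi_pos hw
  linarith

theorem hasDerivAt_tailLog {w : ℂ} (hw : 0 < w.im) :
    HasDerivAt tailLog (tailLogDeriv w) w := by
  have h1 : HasDerivAt (Function.Periodic.qParam 1)
      (2 * π * Complex.I * Function.Periodic.qParam 1 w) w := by
    have := ((hasDerivAt_id w).const_mul (2 * π * Complex.I)).cexp
    convert! this using 1
    · ext x; simp [Function.Periodic.qParam]
    · simp [Function.Periodic.qParam, mul_comm]
  exact ((differentiableAt_eulerLog (norm_qParam_one_lt_one hw)).hasDerivAt.comp w h1).const_mul 24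

theorem continuousAt_tailLogDeriv {w : ℂ} (hw : 0 < w.im) : ContinuousAt tailLogDeriv w := by
  have h1 : ContinuousAt (Function.Periodic.qParam 1) w := by
    unfold Function.Periodic.qParam
    fun_prop
  have h2 := (continuousAt_deriv_eulerLog (norm_qParam_one_lt_one hw)).comp h1
  exact continuousAt_const.mul (h2.mul (continuousAt_const.mul h1))

theorem tendsto_qParam_one :
    Filter.Tendsto (Function.Periodic.qParam 1) (Filter.comap Complex.im Filter.atTop) (nhds 0) :=
  (Function.Periodic.qParam_tendsto one_pos).mono_right nhdsWithin_le_nhds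

theorem tendsto_tailLog :
    Filter.Tendsto tailLog (Filter.comap Complex.im Filter.atTop) (nhds 0) := by
  have h := (differentiableAt_eulerLog (q := 0) (by simp)).continuousAt.tendsto.comp
    tendsto_qParam_one
  rw [eulerLog_zero] at h
  simpa only [mul_zero] using! h.const_mul 24

theorem tailLogDeriv_isBigO :
    tailLogDeriv =O[Filter.comap Complex.im Filter.atTop]
      fun w => Real.exp (-2 * π * w.im) := by
  have h1 := ((continuousAt_deriv_eulerLog (q := 0) (by simp)).tendsto.comp
    tendsto_qParam_one).isBigO_one ℝ
  have h2 : Function.Periodic.qParam 1 =O[Filter.comap Complex.im Filter.atTop]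
      fun w => Real.exp (-2 * π * w.im) :=
    Asymptotics.IsBigO.of_norm_le fun w => (norm_qParam_one w).le
  simpa [Function.comp_def] using! (h1.mul (h2.const_mul_left (2 * π * Complex.I))).const_mul_left 24

theorem tendsto_tailLogDeriv :
    Filter.Tendsto tailLogDeriv (Filter.comap Complex.im Filter.atTop) (nhds 0) := by
  refine tailLogDeriv_isBigO.trans_tendsto ?_
  have h : Filter.Tendsto (fun y : ℝ => Real.exp (-2 * π * y)) Filter.atTop (nhds 0) := by
    refine Real.tendsto_exp_atBot.comp ?_
    exact Filter.tendsto_id.const_mul_atTop_of_neg (by have := Real.pi_pos; linarith)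
  exact h.comp Filter.tendsto_comap

theorem tendsto_add_mul_I (u : ℂ) {s : ℝ} (hs : 0 < s) :
    Filter.Tendsto (fun t : ℝ => u + s * (t * Complex.I)) Filter.atTop
      (Filter.comap Complex.im Filter.atTop) := by
  rw [Filter.tendsto_comap_iff]
  have : Complex.im ∘ (fun t : ℝ => u + s * (t * Complex.I)) = fun t => u.im + s * t := by
    ext t; simp
  rw [this]
  exact Filter.tendsto_atTop_add_const_left _ _ (Filter.tendsto_id.const_mul_atTop hs)

/-- The derivative decays exponentially up the ray. The scale s is needed because the primitive of
`mu γ` involves `tailLog` at s·z + t. -/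
theorem integrableOn_tailLogDeriv {u : ℂ} (hu : 0 < u.im) {s : ℝ} (hs : 0 < s) :
    MeasureTheory.IntegrableOn (fun t : ℝ => tailLogDeriv (u + s * (t * Complex.I)))
      (Set.Ioi 0) := by
  have hcont : ContinuousOn (fun t : ℝ => tailLogDeriv (u + s * (t * Complex.I))) (Set.Ici 0) := by
    intro t ht
    have him : 0 < (u + s * (t * Complex.I)).im := by
      simp
      have := mul_nonneg hs.le (Set.mem_Ici.mp ht)
      linarith
    have h2 : ContinuousAt (fun t : ℝ => u + s * (t * Complex.I)) t := by fun_prop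
    exact (ContinuousAt.comp (f := fun t : ℝ => u + s * (t * Complex.I))
      (continuousAt_tailLogDeriv him) h2).continuousWithinAt
  have hO := tailLogDeriv_isBigO.comp_tendsto (tendsto_add_mul_I u hs)
  have hO' : (fun t : ℝ => ‖tailLogDeriv (u + s * (t * Complex.I))‖) =O[Filter.atTop]
      fun t => Real.exp (-(2 * π * s) * t) := by
    refine hO.norm_left.trans (Asymptotics.IsBigO.of_bound (Real.exp (-2 * π * u.im)) ?_)
    refine Filter.Eventually.of_forall fun t => ?_
    rw [Real.norm_of_nonneg (Real.exp_pos _).le, ← Real.exp_add]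
    simp only [Function.comp_apply, Real.norm_of_nonneg (Real.exp_pos _).le]
    apply le_of_eq
    simp
    ring
  have h3 := integrable_of_isBigO_exp_neg (by positivity) hcont.norm hO'
  exact (MeasureTheory.integrable_norm_iff
    (hcont.mono Set.Ioi_subset_Ici_self |>.aestronglyMeasurable measurableSet_Ioi)).mp h3

/-- A holomorphic logarithm of `Δ`, that is, `24` times a logarithm of `η`. -/
def discLog (w : ℂ) : ℂ := 2 * π * Complex.I * w + tailLog w

theorem hasDerivAt_discLog {w : ℂ} (hw : 0 < w.im) :
    HasDerivAt discLog (2 * π * Complex.I + tailLogDeriv w) w := by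
  simpa using! ((hasDerivAt_id w).const_mul (2 * π * Complex.I)).add (hasDerivAt_tailLog hw)

theorem exp_discLog (z : ℍ) : Complex.exp (discLog z) = discriminant z := by
  have hq := norm_qParam_one_lt_one z.2
  rw [discriminant_eq_q_prod, discLog, Complex.exp_add, tailLog,
    show (24 : ℂ) = (24 : ℕ) by norm_num, Complex.exp_nat_mul, exp_eulerLog hq,
    ← Multipliable.tprod_pow (multipliable_one_sub_pow hq)]
  simp [Function.Periodic.qParam, eta_q]

theorem discLog_add_one (w : ℂ) : discLog (w + 1) = discLog w + 2 * π * Complex.I := by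
  have h : Function.Periodic.qParam 1 (w + 1) = Function.Periodic.qParam 1 w := by
    simp [Function.Periodic.qParam, mul_add, Complex.exp_add]
  rw [discLog, discLog, tailLog, tailLog, h]
  ring

/-! ### The rational action and the chosen branch of the logarithm -/

theorem incl_apply (γ : SL(2, ℚ)) (i j : Fin 2) : incl γ i j = (γ i j : ℝ) := by
  simp [incl]

theorem incl_mul (γ₁ γ₂ : SL(2, ℚ)) : incl (γ₁ * γ₂) = incl γ₁ * incl γ₂ := map_mul _ _ _

theorem incl_one : incl 1 = 1 := map_one _

theorem denom_incl (γ : SL(2, ℚ)) (w : ℂ) :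
    denom (incl γ) w = (γ 1 0 : ℂ) * w + (γ 1 1 : ℂ) := by
  simp [denom, incl]

theorem num_incl (γ : SL(2, ℚ)) (w : ℂ) :
    num (incl γ) w = (γ 0 0 : ℂ) * w + (γ 0 1 : ℂ) := by
  simp [num, incl]

theorem coe_incl_smul (γ : SL(2, ℚ)) (z : ℍ) :
    ((incl γ • z : ℍ) : ℂ) = num (incl γ) z / denom (incl γ) z :=
  coe_smul_of_det_pos (by simp [incl]) z

theorem incl_ofInt (σ : SL(2, ℤ)) : incl (ofInt σ) = (σ : GL (Fin 2) ℝ) := by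
  ext i j
  simp [incl]

theorem slash_incl_apply (f : ℍ → ℂ) (k : ℤ) (γ : SL(2, ℚ)) (z : ℍ) :
    (f ∣[k] incl γ) z = f (incl γ • z) * denom (incl γ) z ^ (-k) := by
  simp [slash_apply, incl, UpperHalfPlane.σ]

theorem exp_logLow {w : ℂ} (hw : w ≠ 0) : Complex.exp (logLow w) = w := by
  rw [logLow]
  split_ifs
  · rw [Complex.exp_sub, Complex.exp_two_pi_mul_I, div_one, Complex.exp_log hw]
  · exact Complex.exp_log hw

theorem logLow_eq_log {w : ℂ} (hw : w.im ≠ 0) : logLow w = Complex.log w := by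
  rw [logLow, if_neg]
  intro h
  exact hw (Complex.arg_eq_pi_iff.mp h).2

/-- Positive scaling leaves the argument, hence the branch, unchanged. This makes the Euler cocycle
vanish when the right factor is upper triangular with positive diagonal. -/
theorem logLow_real_mul {r : ℝ} (hr : 0 < r) {w : ℂ} (hw : w ≠ 0) :
    logLow (r * w) = Real.log r + logLow w := by
  rw [logLow, logLow, Complex.arg_real_mul _ hr, Complex.log_ofReal_mul hr hw]
  split_ifs <;> ring

theorem logLow_ofReal {r : ℝ} (hr : 0 < r) : logLow r = Real.log r := by
  have := logLow_real_mul hr one_ne_zero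
  have h1 : logLow 1 = 0 := by simp [logLow, Real.pi_ne_zero.symm]
  rwa [mul_one, h1, add_zero] at this

theorem denom_incl_im (γ : SL(2, ℚ)) (w : ℂ) : (denom (incl γ) w).im = γ 1 0 * w.im := by
  rw [denom_incl]
  simp

/-- On ℍ the factor cz + d is either constant or off the real axis, so the cut is never crossed. -/
theorem differentiableAt_logLow_denom (γ : SL(2, ℚ)) (z : ℍ) :
    DifferentiableAt ℂ (fun w => logLow (denom (incl γ) w)) z := by
  by_cases hc : γ 1 0 = 0
  · simp [denom_incl, hc]
  · have hd : DifferentiableAt ℂ (denom (incl γ)) z := by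
      unfold denom
      fun_prop
    have him : (denom (incl γ) z).im ≠ 0 := by
      rw [denom_incl_im]
      exact mul_ne_zero (by exact_mod_cast hc) z.im_ne_zero
    refine (hd.clog (Or.inr him)).congr_of_eventuallyEq ?_
    have hcont : ContinuousAt (fun w => (denom (incl γ) w).im) z :=
      Complex.continuous_im.continuousAt.comp hd.continuousAt
    filter_upwards [hcont.eventually_ne him] with w hw
    exact logLow_eq_log hw

/-- The derivative of a Möbius transformation. -/
theorem hasDerivAt_moebius (γ : SL(2, ℚ)) (z : ℍ) :
    HasDerivAt (fun w => num (incl γ) w / denom (incl γ) w) (denom (incl γ) z ^ (-2 : ℤ)) z := by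
  have hn : HasDerivAt (num (incl γ)) (incl γ 0 0 : ℂ) z := by
    simpa only [mul_one] using!
      ((hasDerivAt_id (z : ℂ)).const_mul (incl γ 0 0 : ℂ)).add_const (incl γ 0 1 : ℂ)
  have hd : HasDerivAt (denom (incl γ)) (incl γ 1 0 : ℂ) z := by
    simpa only [mul_one] using!
      ((hasDerivAt_id (z : ℂ)).const_mul (incl γ 1 0 : ℂ)).add_const (incl γ 1 1 : ℂ)
  have hne := denom_ne_zero (incl γ) z
  convert! hn.div hd hne using 1
  rw [zpow_neg, eq_div_iff (pow_ne_zero 2 hne), zpow_ofNat, inv_mul_cancel₀ (pow_ne_zero 2 hne)]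
  have hdet := γ.det_coe
  rw [Matrix.det_fin_two] at hdet
  have hdet' : (γ 0 0 : ℂ) * γ 1 1 - γ 0 1 * γ 1 0 = 1 := by exact_mod_cast hdet
  rw [num_incl, denom_incl, incl_apply, incl_apply]
  push_cast
  linear_combination -hdet'

/-! ### The primitive of `mu` and the Euler cocycle -/

/-- A primitive of `mu γ`. -/
def muPrim (γ : SL(2, ℚ)) (w : ℂ) : ℂ :=
  1 / (12 * π * Complex.I) * (discLog (num (incl γ) w / denom (incl γ) w) -
    12 * logLow (denom (incl γ) w) - discLog w)

theorem muPrim_coe (γ : SL(2, ℚ)) (z : ℍ) :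
    muPrim γ z = 1 / (12 * π * Complex.I) * (discLog (incl γ • z : ℍ) -
      12 * logLow (denom (incl γ) z) - discLog z) := by
  rw [muPrim, coe_incl_smul]

theorem differentiableAt_muPrim (γ : SL(2, ℚ)) (z : ℍ) : DifferentiableAt ℂ (muPrim γ) z := by
  have h1 : DifferentiableAt ℂ (fun w => discLog (num (incl γ) w / denom (incl γ) w)) z := by
    refine DifferentiableAt.comp (g := discLog) (z : ℂ) ?_ (hasDerivAt_moebius γ z).differentiableAt
    rw [← coe_incl_smul]
    exact (hasDerivAt_discLog (incl γ • z).2).differentiableAt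
  exact ((h1.sub ((differentiableAt_logLow_denom γ z).const_mul 12)).sub
    (hasDerivAt_discLog z.2).differentiableAt).const_mul _

theorem exp_muPrim (γ : SL(2, ℚ)) (z : ℍ) :
    Complex.exp (12 * π * Complex.I * muPrim γ z) =
      (discriminant ∣[(12 : ℤ)] incl γ) z / discriminant z := by
  have hpi : (12 * π * Complex.I : ℂ) ≠ 0 := by simp [Real.pi_ne_zero]
  rw [muPrim_coe, ← mul_assoc, mul_one_div_cancel hpi, one_mul, Complex.exp_sub, Complex.exp_sub,
    exp_discLog, exp_discLog, show (12 : ℂ) = (12 : ℕ) by norm_num, Complex.exp_nat_mul,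
    exp_logLow (denom_ne_zero _ z), slash_incl_apply, zpow_neg, div_eq_mul_inv _ (_ ^ 12)]
  rfl

theorem eventually_mem_upperHalfPlane (z : ℍ) : ∀ᶠ w : ℂ in nhds (z : ℂ), 0 < w.im :=
  (Complex.continuous_im.isOpen_preimage _ isOpen_Ioi).mem_nhds z.2

/-- Exponentiating 12πi times `muPrim γ` recovers Δ|γ / Δ whatever the branches, so its derivative
is the logarithmic derivative defining `mu γ`. -/
theorem hasDerivAt_muPrim (γ : SL(2, ℚ)) (z : ℍ) : HasDerivAt (muPrim γ) (mu γ z) z := by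
  have hpi : (12 * π * Complex.I : ℂ) ≠ 0 := by simp [Real.pi_ne_zero]
  have hP := (differentiableAt_muPrim γ z).hasDerivAt
  have he : (fun w : ℂ => (discriminant ∣[(12 : ℤ)] incl γ) (ofComplex w) /
      discriminant (ofComplex w)) =ᶠ[nhds (z : ℂ)]
      fun w => Complex.exp (12 * π * Complex.I * muPrim γ w) := by
    filter_upwards [eventually_mem_upperHalfPlane z] with w hw
    rw [← exp_muPrim, ofComplex_apply_of_im_pos hw]
  have hmu : mu γ z = deriv (muPrim γ) z := by
    rw [mu, logDeriv_apply, he.deriv_eq, he.eq_of_nhds,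
      ((hP.const_mul (12 * π * Complex.I)).cexp).deriv]
    have := Complex.exp_ne_zero (12 * π * Complex.I * muPrim γ z)
    field_simp
  rwa [hmu]

theorem eulerCocycle_eq (z : ℍ) (γ₁ γ₂ : SL(2, ℚ)) :
    eulerCocycle z (Matrix.SpecialLinearGroup.map (algebraMap ℚ ℝ) γ₁)
      (Matrix.SpecialLinearGroup.map (algebraMap ℚ ℝ) γ₂) =
    1 / (2 * π * Complex.I) * (logLow (denom (incl γ₂) z) +
      logLow (denom (incl γ₁) (incl γ₂ • z : ℍ)) - logLow (denom (incl (γ₁ * γ₂)) z)) := by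
  rw [eulerCocycle, ← map_mul]
  rfl

/-- Exponentiation turns the sum of logarithms into the chain rule for the automorphy factor. -/
theorem exists_int_eulerCocycle (z : ℍ) (γ₁ γ₂ : SL(2, ℚ)) :
    ∃ n : ℤ, eulerCocycle z (Matrix.SpecialLinearGroup.map (algebraMap ℚ ℝ) γ₁)
      (Matrix.SpecialLinearGroup.map (algebraMap ℚ ℝ) γ₂) = n := by
  have hpi : (2 * π * Complex.I : ℂ) ≠ 0 := by simp [Real.pi_ne_zero]
  have h : Complex.exp (logLow (denom (incl γ₂) z) +
      logLow (denom (incl γ₁) (incl γ₂ • z : ℍ)) - logLow (denom (incl (γ₁ * γ₂)) z)) = 1 := by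
    rw [Complex.exp_sub, Complex.exp_add, exp_logLow (denom_ne_zero _ z),
      exp_logLow (denom_ne_zero _ _), exp_logLow (denom_ne_zero _ z), incl_mul]
    have hc : denom (incl γ₁ * incl γ₂) z = denom (incl γ₁) (incl γ₂ • z : ℍ) *
        denom (incl γ₂) z := by
      rw [denom_cocycle _ _ z.im_ne_zero, coe_incl_smul]
    rw [mul_comm, ← hc, div_self (denom_ne_zero _ z)]
  obtain ⟨n, hn⟩ := Complex.exp_eq_one_iff.mp h
  refine ⟨n, ?_⟩
  rw [eulerCocycle_eq, hn]
  field_simp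

theorem continuous_logLow_denom (γ : SL(2, ℚ)) :
    Continuous fun z : ℍ => logLow (denom (incl γ) z) :=
  continuous_iff_continuousAt.mpr fun z =>
    (differentiableAt_logLow_denom γ z).continuousAt.comp UpperHalfPlane.continuous_coe.continuousAt

/-- A continuous integer-valued function on the connected space ℍ is constant. -/
theorem eulerCocycle_const (z z' : ℍ) (γ₁ γ₂ : SL(2, ℚ)) :
    eulerCocycle z (Matrix.SpecialLinearGroup.map (algebraMap ℚ ℝ) γ₁)
      (Matrix.SpecialLinearGroup.map (algebraMap ℚ ℝ) γ₂) =
    eulerCocycle z' (Matrix.SpecialLinearGroup.map (algebraMap ℚ ℝ) γ₁)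
      (Matrix.SpecialLinearGroup.map (algebraMap ℚ ℝ) γ₂) := by
  choose n hn using fun z => exists_int_eulerCocycle z γ₁ γ₂
  have hcont : Continuous fun z => ((n z : ℝ) : ℂ) := by
    have : (fun z => ((n z : ℝ) : ℂ)) = fun z : ℍ => 1 / (2 * π * Complex.I) *
        (logLow (denom (incl γ₂) z) + logLow (denom (incl γ₁) (incl γ₂ • z : ℍ)) -
          logLow (denom (incl (γ₁ * γ₂)) z)) := by
      ext z
      rw [← eulerCocycle_eq, hn]
      simp
    rw [this]
    have h2 : Continuous fun z : ℍ => incl γ₂ • z := continuous_const_smul _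
    exact continuous_const.mul (((continuous_logLow_denom γ₂).add
      ((continuous_logLow_denom γ₁).comp h2)).sub (continuous_logLow_denom (γ₁ * γ₂)))
  have hn' : Continuous n := Int.isClosedEmbedding_coe_real.isEmbedding.continuous_iff.mpr
    (Complex.isUniformEmbedding_ofReal.isEmbedding.continuous_iff.mpr hcont)
  rw [hn, hn, PreconnectedSpace.constant inferInstance hn']

/-- The values of log Δ telescope and only the automorphy logarithms survive; the factor 2 is
12/(12πi) divided by 1/(2πi). -/
theorem muPrim_mul (γ₁ γ₂ : SL(2, ℚ)) (z : ℍ) :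
    muPrim (γ₁ * γ₂) z = muPrim γ₁ (incl γ₂ • z : ℍ) + muPrim γ₂ z +
      2 * eulerCocycle z (Matrix.SpecialLinearGroup.map (algebraMap ℚ ℝ) γ₁)
        (Matrix.SpecialLinearGroup.map (algebraMap ℚ ℝ) γ₂) := by
  rw [muPrim_coe, muPrim_coe, muPrim_coe, eulerCocycle_eq, incl_mul, mul_smul]
  have : (π : ℂ) ≠ 0 := by simp [Real.pi_ne_zero]
  field_simp
  ring

/-- The cocycle property of `mu`. -/
theorem mu_slash (γ₁ γ₂ : SL(2, ℚ)) :
    mu γ₁ ∣[(2 : ℤ)] incl γ₂ = mu (γ₁ * γ₂) - mu γ₂ := by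
  ext z
  rw [slash_incl_apply]
  -- Differentiate `muPrim_mul`: the Euler term is locally constant in z and drops out.
  have h1 : HasDerivAt (fun w => muPrim γ₁ (num (incl γ₂) w / denom (incl γ₂) w))
      (mu γ₁ (incl γ₂ • z) * denom (incl γ₂) z ^ (-2 : ℤ)) z := by
    refine HasDerivAt.comp (h₂ := muPrim γ₁) (z : ℂ) ?_ (hasDerivAt_moebius γ₂ z)
    rw [← coe_incl_smul]
    exact hasDerivAt_muPrim γ₁ _
  have h2 := (((hasDerivAt_muPrim (γ₁ * γ₂) z).sub (hasDerivAt_muPrim γ₂ z))).sub_const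
    (2 * eulerCocycle z (Matrix.SpecialLinearGroup.map (algebraMap ℚ ℝ) γ₁)
        (Matrix.SpecialLinearGroup.map (algebraMap ℚ ℝ) γ₂))
  refine h1.unique (h2.congr_of_eventuallyEq ?_)
  filter_upwards [eventually_mem_upperHalfPlane z] with w hw
  have := muPrim_mul γ₁ γ₂ ⟨w, hw⟩
  rw [eulerCocycle_const _ z, coe_incl_smul] at this
  simp only [Pi.sub_apply]
  linear_combination -this

theorem mu_one : mu 1 = 0 := by
  have := mu_slash 1 1
  rw [incl_one, SlashAction.slash_one, mul_one, sub_self] at this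
  exact this

/-! ### Values on SL(2,ℤ): the transformation formula of log Δ -/

theorem mu_ofInt (σ : SL(2, ℤ)) : mu (ofInt σ) = 0 := by
  ext z
  have h : discriminant ∣[(12 : ℤ)] incl (ofInt σ) = discriminant := by
    rw [incl_ofInt]
    exact SlashInvariantForm.slash_action_generators_SL2Z discriminant_S_invariant discriminant_T_invariant σ
  have h1 : (fun w : ℂ => discriminant (ofComplex w) / discriminant (ofComplex w)) =
      fun _ => (1 : ℂ) := by
    ext w
    exact div_self (discriminant_ne_zero _)
  rw [mu, h, h1]
  simp

theorem muPrim_ofInt_const (σ : SL(2, ℤ)) (z z' : ℍ) :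
    muPrim (ofInt σ) z = muPrim (ofInt σ) z' := by
  have hd : ∀ w ∈ upperHalfPlaneSet, HasDerivAt (muPrim (ofInt σ)) 0 w := fun w hw => by
    simpa [mu_ofInt] using hasDerivAt_muPrim (ofInt σ) ⟨w, hw⟩
  exact isOpen_upperHalfPlaneSet.is_const_of_deriv_eq_zero
    (convex_halfSpace_im_gt 0).isPreconnected
    (fun w hw => (hd w hw).differentiableAt.differentiableWithinAt)
    (fun w hw => (hd w hw).deriv) z.2 z'.2

theorem logLow_one : logLow 1 = 0 := by
  simpa using logLow_ofReal one_pos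

theorem logLow_neg_one : logLow (-1) = -(π * Complex.I) := by
  rw [logLow, if_pos Complex.arg_neg_one, Complex.log_neg_one]
  ring

theorem im_logLow_of_im_pos {w : ℂ} (hw : 0 < w.im) :
    0 < (logLow w).im ∧ (logLow w).im < π := by
  rw [logLow_eq_log hw.ne', Complex.log_im]
  refine ⟨lt_of_le_of_ne (Complex.arg_nonneg_iff.mpr hw.le) fun h => ?_,
    lt_of_le_of_ne (Complex.arg_le_pi w) fun h => ?_⟩
  · exact hw.ne' (Complex.arg_eq_zero_iff.mp h.symm).2
  · exact hw.ne' (Complex.arg_eq_pi_iff.mp h).2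

theorem im_logLow_of_im_neg {w : ℂ} (hw : w.im < 0) :
    -π < (logLow w).im ∧ (logLow w).im < 0 := by
  rw [logLow_eq_log hw.ne, Complex.log_im]
  exact ⟨Complex.neg_pi_lt_arg w, Complex.arg_neg_iff.mpr hw⟩

/-- The cocycle is an integer, so strict bounds at distance one on either side determine it; rough
bounds on arguments then suffice. -/
theorem eulerCocycle_eq_of_im (z : ℍ) (γ₁ γ₂ : SL(2, ℚ)) (n : ℤ)
    (h1 : 2 * π * (n - 1) < (logLow (denom (incl γ₂) z)).im +
      (logLow (denom (incl γ₁) (incl γ₂ • z : ℍ))).im - (logLow (denom (incl (γ₁ * γ₂)) z)).im)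
    (h2 : (logLow (denom (incl γ₂) z)).im + (logLow (denom (incl γ₁) (incl γ₂ • z : ℍ))).im -
      (logLow (denom (incl (γ₁ * γ₂)) z)).im < 2 * π * (n + 1)) :
    eulerCocycle z (Matrix.SpecialLinearGroup.map (algebraMap ℚ ℝ) γ₁)
      (Matrix.SpecialLinearGroup.map (algebraMap ℚ ℝ) γ₂) = n := by
  obtain ⟨m, hm⟩ := exists_int_eulerCocycle z γ₁ γ₂
  have hpi : (2 * π * Complex.I : ℂ) ≠ 0 := by simp [Real.pi_ne_zero]
  have h := hm
  rw [eulerCocycle_eq, one_div, inv_mul_eq_iff_eq_mul₀ hpi] at h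
  have him := congrArg Complex.im h
  have e : (2 * π * Complex.I * m : ℂ).im = 2 * π * m := by simp
  rw [Complex.sub_im, Complex.add_im, e] at him
  rw [him] at h1 h2
  have hp : (0 : ℝ) < 2 * π := by positivity
  have h1' := lt_of_mul_lt_mul_left h1 hp.le
  have h2' := lt_of_mul_lt_mul_left h2 hp.le
  have h3 : n - 1 < m := by exact_mod_cast h1'
  have h4 : m < n + 1 := by exact_mod_cast h2'
  have : m = n := by omega
  rw [hm, this]

theorem denom_incl_ofInt (σ : SL(2, ℤ)) (z : ℍ) :
    denom (incl (ofInt σ)) z = (σ 1 0 : ℂ) * z + (σ 1 1 : ℂ) := by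
  simp [denom_incl]

theorem denom_incl_S (w : ℂ) : denom (incl (ofInt ModularGroup.S)) w = w := by
  simp [denom_incl, ModularGroup.coe_S]

theorem denom_incl_T (w : ℂ) : denom (incl (ofInt ModularGroup.T)) w = 1 := by
  simp [denom_incl, ModularGroup.coe_T]

/-- The three automorphy factors are cz + d, σz and az + b, and the signs of a and c decide in which
half-plane they lie. The constant 1/4 is −Φ̃(S). -/
theorem eulerCocycle_S (z : ℍ) (σ : SL(2, ℤ)) :
    eulerCocycle z (Matrix.SpecialLinearGroup.map (algebraMap ℚ ℝ) (ofInt ModularGroup.S))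
      (Matrix.SpecialLinearGroup.map (algebraMap ℚ ℝ) (ofInt σ)) =
    (rademacherInt (ModularGroup.S * σ) : ℂ) - rademacherInt σ + 1 / 4 := by
  have s10 : (ModularGroup.S * σ) 1 0 = σ 0 0 := by
    simp [Matrix.SpecialLinearGroup.coe_mul, ModularGroup.coe_S, Matrix.mul_apply,
      Fin.sum_univ_two]
  have s11 : (ModularGroup.S * σ) 1 1 = σ 0 1 := by
    simp [Matrix.SpecialLinearGroup.coe_mul, ModularGroup.coe_S, Matrix.mul_apply,
      Fin.sum_univ_two]
  have s00 : (ModularGroup.S * σ) 0 0 = -σ 1 0 := by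
    simp [Matrix.SpecialLinearGroup.coe_mul, ModularGroup.coe_S, Matrix.mul_apply,
      Fin.sum_univ_two]
  have s01 : (ModularGroup.S * σ) 0 1 = -σ 1 1 := by
    simp [Matrix.SpecialLinearGroup.coe_mul, ModularGroup.coe_S, Matrix.mul_apply,
      Fin.sum_univ_two]
  have hd := σ.det_coe
  rw [Matrix.det_fin_two] at hd
  have hw := im_logLow_of_im_pos (incl (ofInt σ) • z).2
  have hdS : denom (incl (ofInt ModularGroup.S * ofInt σ)) z = (σ 0 0 : ℂ) * z + (σ 0 1 : ℂ) := by
    rw [← map_mul, denom_incl_ofInt, s10, s11]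
  have im_lin : ∀ p q : ℤ, ((p : ℂ) * z + q).im = p * z.im := by
    intro p q; simp
  have im_pos : ∀ p q : ℤ, 0 < p → 0 < ((p : ℂ) * z + q).im := by
    intro p q hp
    rw [im_lin]
    exact mul_pos (by exact_mod_cast hp) z.im_pos
  have im_neg : ∀ p q : ℤ, p < 0 → ((p : ℂ) * z + q).im < 0 := by
    intro p q hp
    rw [im_lin]
    exact mul_neg_of_neg_of_pos (by exact_mod_cast hp) z.im_pos
  have hpi := Real.pi_pos
  have key : ∀ n : ℤ, (rademacherInt (ModularGroup.S * σ) - rademacherInt σ + 1 / 4 = n) →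
      2 * π * (n - 1) < (logLow ((σ 1 0 : ℂ) * z + (σ 1 1 : ℂ))).im +
        (logLow (incl (ofInt σ) • z : ℍ)).im - (logLow ((σ 0 0 : ℂ) * z + (σ 0 1 : ℂ))).im →
      (logLow ((σ 1 0 : ℂ) * z + (σ 1 1 : ℂ))).im +
        (logLow (incl (ofInt σ) • z : ℍ)).im - (logLow ((σ 0 0 : ℂ) * z + (σ 0 1 : ℂ))).im <
          2 * π * (n + 1) →
      eulerCocycle z (Matrix.SpecialLinearGroup.map (algebraMap ℚ ℝ) (ofInt ModularGroup.S))
        (Matrix.SpecialLinearGroup.map (algebraMap ℚ ℝ) (ofInt σ)) =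
      (rademacherInt (ModularGroup.S * σ) : ℂ) - rademacherInt σ + 1 / 4 := by
    intro n hn h1 h2
    rw [eulerCocycle_eq_of_im z _ _ n (by rwa [denom_incl_ofInt, denom_incl_S, hdS])
      (by rwa [denom_incl_ofInt, denom_incl_S, hdS])]
    have := congrArg (fun x : ℚ => (x : ℂ)) hn
    push_cast at this
    exact this.symm
  -- Reciprocity needs both a and c nonzero; the two degenerate cases are computed directly.
  by_cases hc : σ 1 0 = 0
  · rw [hc, mul_zero, sub_zero] at hd
    have hrad : rademacherInt (ModularGroup.S * σ) - rademacherInt σ + 1 / 4 = (0 : ℤ) := by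
      rcases Int.eq_one_or_neg_one_of_mul_eq_one' hd with h | h <;>
        simp [rademacherInt, s00, s10, s11, hc, h.1, h.2, dedekindSum] <;>
        ring
    refine key 0 hrad ?_ ?_
    all_goals
      rcases Int.eq_one_or_neg_one_of_mul_eq_one' hd with h | h
      · have hv := im_logLow_of_im_pos (im_pos (σ 0 0) (σ 0 1) (by omega))
        rw [hc, h.2]
        simp only [Int.cast_zero, zero_mul, zero_add, Int.cast_one, logLow_one, Complex.zero_im]
        linarith
      · have hv := im_logLow_of_im_neg (im_neg (σ 0 0) (σ 0 1) (by omega))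
        rw [hc, h.2]
        simp only [Int.cast_zero, zero_mul, zero_add, Int.cast_one, Int.cast_neg, logLow_neg_one]
        simp only [Complex.neg_im, Complex.im_ofReal_mul, Complex.I_im]
        linarith
  by_cases ha : σ 0 0 = 0
  · rw [ha, zero_mul, zero_sub, ← neg_mul] at hd
    have hbc : (σ 0 1 = -1 ∧ σ 1 0 = 1) ∨ (σ 0 1 = 1 ∧ σ 1 0 = -1) := by
      rcases Int.eq_one_or_neg_one_of_mul_eq_one' hd with h | h <;> omega
    rcases hbc with h | h
    -- Here az + b = −1, and the convention log(−1) = −πi makes the value 1; with +πi it would be 0.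
    · have hu := im_logLow_of_im_pos (im_pos (σ 1 0) (σ 1 1) (by omega))
      refine key 1 ?_ ?_ ?_
      · simp [rademacherInt, s01, s10, s11, ha, h.1, h.2, dedekindSum]
        ring
      all_goals
        rw [ha, h.1]
        simp only [Int.cast_zero, zero_mul, zero_add, Int.cast_one, Int.cast_neg, logLow_neg_one]
        simp only [Complex.neg_im, Complex.im_ofReal_mul, Complex.I_im]
        linarith
    · have hu := im_logLow_of_im_neg (im_neg (σ 1 0) (σ 1 1) (by omega))
      refine key 0 ?_ ?_ ?_
      · simp [rademacherInt, s01, s10, s11, ha, h.1, h.2, dedekindSum]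
        ring
      all_goals
        rw [ha, h.1]
        simp only [Int.cast_zero, zero_mul, zero_add, Int.cast_one, logLow_one, Complex.zero_im]
        linarith
  have hrad := rademacherInt_S_mul ha hc
  rcases lt_or_gt_of_ne hc with hc' | hc' <;> rcases lt_or_gt_of_ne ha with ha' | ha'
  · have hu := im_logLow_of_im_neg (im_neg (σ 1 0) (σ 1 1) hc')
    have hv := im_logLow_of_im_neg (im_neg (σ 0 0) (σ 0 1) ha')
    rw [Int.sign_eq_neg_one_of_neg hc', Int.sign_eq_neg_one_of_neg ha'] at hrad
    refine key 0 (by rw [hrad]; norm_num) ?_ ?_ <;> push_cast <;> linarith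
  · have hu := im_logLow_of_im_neg (im_neg (σ 1 0) (σ 1 1) hc')
    have hv := im_logLow_of_im_pos (im_pos (σ 0 0) (σ 0 1) ha')
    rw [Int.sign_eq_neg_one_of_neg hc', Int.sign_eq_one_of_pos ha'] at hrad
    refine key 0 (by rw [hrad]; norm_num) ?_ ?_ <;> push_cast <;> linarith
  · have hu := im_logLow_of_im_pos (im_pos (σ 1 0) (σ 1 1) hc')
    have hv := im_logLow_of_im_neg (im_neg (σ 0 0) (σ 0 1) ha')
    rw [Int.sign_eq_one_of_pos hc', Int.sign_eq_neg_one_of_neg ha'] at hrad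
    refine key 1 (by rw [hrad]; norm_num) ?_ ?_ <;> push_cast <;> linarith
  · have hu := im_logLow_of_im_pos (im_pos (σ 1 0) (σ 1 1) hc')
    have hv := im_logLow_of_im_pos (im_pos (σ 0 0) (σ 0 1) ha')
    rw [Int.sign_eq_one_of_pos hc', Int.sign_eq_one_of_pos ha'] at hrad
    refine key 0 (by rw [hrad]; norm_num) ?_ ?_ <;> push_cast <;> linarith

theorem eulerCocycle_T (z : ℍ) (σ : SL(2, ℤ)) :
    eulerCocycle z (Matrix.SpecialLinearGroup.map (algebraMap ℚ ℝ) (ofInt ModularGroup.T))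
      (Matrix.SpecialLinearGroup.map (algebraMap ℚ ℝ) (ofInt σ)) = 0 := by
  rw [eulerCocycle_eq, denom_incl_T, logLow_one, ← map_mul, denom_incl_ofInt, denom_incl_ofInt]
  simp

/-- Evaluate at the fixed point i: the two logarithms of Δ cancel, leaving −12 log i. -/
theorem muPrim_S (z : ℍ) : muPrim (ofInt ModularGroup.S) z = -1 / 2 := by
  have hI : incl (ofInt ModularGroup.S) • UpperHalfPlane.I = UpperHalfPlane.I := by
    ext
    rw [coe_incl_smul, denom_incl_S, num_incl]
    simp [ModularGroup.coe_S]
  have hl : logLow (UpperHalfPlane.I : ℍ) = π / 2 * Complex.I := by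
    rw [logLow_eq_log (by simp)]
    simp [Complex.log_I]
  rw [muPrim_ofInt_const _ z UpperHalfPlane.I, muPrim_coe, hI, denom_incl_S, hl]
  have : (π : ℂ) ≠ 0 := by simp [Real.pi_ne_zero]
  field_simp
  ring

theorem muPrim_T (z : ℍ) : muPrim (ofInt ModularGroup.T) z = 1 / 6 := by
  have hT : ((incl (ofInt ModularGroup.T) • z : ℍ) : ℂ) = z + 1 := by
    rw [coe_incl_smul, denom_incl_T, num_incl]
    simp [ModularGroup.coe_T]
  rw [muPrim_coe, hT, denom_incl_T, logLow_one, discLog_add_one]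
  have : (π : ℂ) ≠ 0 := by simp [Real.pi_ne_zero]
  field_simp
  ring

/-- The transformation formula of `log Δ = 24 log η` under the modular group. -/
theorem muPrim_ofInt (σ : SL(2, ℤ)) (z : ℍ) :
    muPrim (ofInt σ) z = 2 * (rademacherInt σ : ℂ) := by
  -- It suffices that `muPrim` and 2Φ̃ have the same increments under left multiplication by each
  -- generator; the inverse generators follow by solving for the increment.
  have hS : ∀ τ : SL(2, ℤ), muPrim (ofInt (ModularGroup.S * τ)) z =
      muPrim (ofInt τ) z + 2 * (rademacherInt (ModularGroup.S * τ) : ℂ) - 2 * rademacherInt τ := by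
    intro τ
    rw [map_mul, muPrim_mul, muPrim_S, eulerCocycle_S]
    ring
  have hT : ∀ τ : SL(2, ℤ), muPrim (ofInt (ModularGroup.T * τ)) z =
      muPrim (ofInt τ) z + 2 * (rademacherInt (ModularGroup.T * τ) : ℂ) - 2 * rademacherInt τ := by
    intro τ
    rw [map_mul, muPrim_mul, muPrim_T, eulerCocycle_T, rademacherInt_T_mul]
    push_cast
    ring
  have hmem : σ ∈ Subgroup.closure {ModularGroup.S, ModularGroup.T} := by
    simp [SpecialLinearGroup.SL2Z_generators]
  induction hmem using Subgroup.closure_induction_left with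
  | one =>
    rw [map_one, muPrim_coe, incl_one, one_smul, denom_one, logLow_one]
    simp [rademacherInt]
  | mul_left x hx y _ ih =>
    rcases hx with rfl | rfl
    · rw [hS, ih]; ring
    · rw [hT, ih]; ring
  | inv_mul_cancel x hx y _ ih =>
    rcases hx with rfl | rfl
    · have := hS (ModularGroup.S⁻¹ * y)
      rw [mul_inv_cancel_left, ih] at this
      linear_combination -this
    · have := hT (ModularGroup.T⁻¹ * y)
      rw [mul_inv_cancel_left, ih] at this
      linear_combination -this

/-! ### Integrals through primitives -/

theorem segIntegral_eq_sub {f : ℍ → ℂ} {F : ℂ → ℂ} (hF : ∀ z : ℍ, HasDerivAt F (f z) z)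
    (u v : ℍ) : segIntegral f u v = F v - F u := by
  have him : ∀ t ∈ Set.Icc (0 : ℝ) 1, 0 < ((u : ℂ) + t * ((v : ℂ) - u)).im := by
    intro t ht
    have h := (convex_halfSpace_im_gt 0).add_smul_sub_mem (x := (u : ℂ)) (y := (v : ℂ))
      u.im_pos v.im_pos ht
    simpa using h
  have hline : ∀ t : ℝ, HasDerivAt (fun t : ℝ => (u : ℂ) + t * ((v : ℂ) - u)) ((v : ℂ) - u) t := by
    intro t
    simpa using ((Complex.ofRealCLM.hasDerivAt (x := t)).mul_const ((v : ℂ) - u)).const_add (u : ℂ)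
  have hderiv : ∀ t ∈ Set.uIcc (0 : ℝ) 1, HasDerivAt (fun t : ℝ => F ((u : ℂ) + t * ((v : ℂ) - u)))
      (f (ofComplex ((u : ℂ) + t * ((v : ℂ) - u))) * ((v : ℂ) - u)) t := by
    intro t ht
    rw [Set.uIcc_of_le zero_le_one] at ht
    have h := hF ⟨_, him t ht⟩
    rw [ofComplex_apply_of_im_pos (him t ht)]
    exact HasDerivAt.comp (h₂ := F) t h (hline t)
  -- Continuity of f comes for free, as f is the derivative of a holomorphic function.
  have hcont : ContinuousOn (fun w => f (ofComplex w)) upperHalfPlaneSet := by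
    have hd : DifferentiableOn ℂ F upperHalfPlaneSet := fun w hw =>
      (hF ⟨w, hw⟩).differentiableAt.differentiableWithinAt
    refine (hd.deriv isOpen_upperHalfPlaneSet).continuousOn.congr fun w hw => ?_
    rw [ofComplex_apply_of_im_pos hw]
    exact (hF ⟨w, hw⟩).deriv.symm
  rw [segIntegral, intervalIntegral.integral_eq_sub_of_hasDerivAt hderiv]
  · simp
  · refine ContinuousOn.intervalIntegrable ?_
    rw [Set.uIcc_of_le zero_le_one]
    refine ContinuousOn.mul (hcont.comp (fun t _ => (hline t).continuousAt.continuousWithinAt)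
      fun t ht => him t ht) continuousOn_const

theorem add_mul_I_im_pos (u : ℍ) {t : ℝ} (ht : 0 ≤ t) : 0 < ((u : ℂ) + t * Complex.I).im := by
  simp
  linarith [u.im_pos]

theorem cuspIntegral_eq_sub {f : ℍ → ℂ} {F : ℂ → ℂ} (hF : ∀ z : ℍ, HasDerivAt F (f z) z)
    (u : ℍ) (hint : MeasureTheory.IntegrableOn
      (fun t : ℝ => f (ofComplex ((u : ℂ) + t * Complex.I))) (Set.Ioi 0)) {m : ℂ}
    (hlim : Filter.Tendsto (fun t : ℝ => F ((u : ℂ) + t * Complex.I)) Filter.atTop (nhds m)) :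
    cuspIntegral f u = m - F u := by
  have hderiv : ∀ t ∈ Set.Ici (0 : ℝ), HasDerivAt (fun t : ℝ => F ((u : ℂ) + t * Complex.I))
      (f (ofComplex ((u : ℂ) + t * Complex.I)) * Complex.I) t := by
    intro t ht
    have hline : HasDerivAt (fun t : ℝ => (u : ℂ) + t * Complex.I) Complex.I t := by
      simpa using ((Complex.ofRealCLM.hasDerivAt (x := t)).mul_const Complex.I).const_add (u : ℂ)
    have h := hF ⟨_, add_mul_I_im_pos u ht⟩
    rw [ofComplex_apply_of_im_pos (add_mul_I_im_pos u ht)]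
    exact HasDerivAt.comp (h₂ := F) t h hline
  rw [cuspIntegral, MeasureTheory.integral_Ioi_of_hasDerivAt_of_tendsto
    (hderiv 0 Set.self_mem_Ici).continuousAt.continuousWithinAt
    (fun t ht => hderiv t (Set.Ioi_subset_Ici_self ht)) (hint.mul_const Complex.I) hlim]
  simp

/-! ### Asymptotics at the cusp -/

/-- The expansion at `i∞` of the primitive of `mu γ`. -/
theorem exists_muPrim_eq (γ : SL(2, ℚ)) : ∃ s t l : ℝ, 0 < s ∧ ∀ z : ℍ,
    muPrim γ z = 2 * (rademacher γ : ℂ) + l * Complex.I + (s - 1) / 6 * z +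
      1 / (12 * π * Complex.I) * (tailLog (s * z + t) - tailLog z) := by
  obtain ⟨⟨σ, β⟩, hγ, hβ⟩ := exists_factorization γ
  simp only at hγ hβ
  subst hγ
  obtain ⟨hc, hd⟩ := hβ
  have hdet := β.det_coe
  rw [Matrix.det_fin_two, hc, mul_zero, sub_zero] at hdet
  have ha : 0 < β 0 0 := by
    have : 0 < β 0 0 * β 1 1 := by linarith
    exact (pos_iff_pos_of_mul_pos this).mpr hd
  have hdR : (0 : ℝ) < (β 1 1 : ℝ) := by exact_mod_cast hd
  have hdC : (β 1 1 : ℂ) ≠ 0 := by exact_mod_cast hd.ne'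
  have hden : ∀ z : ℍ, denom (incl β) z = ((β 1 1 : ℝ) : ℂ) := by
    intro z
    rw [denom_incl, hc]
    simp
  -- β acts by z ↦ sz + t, and −12 log d / (12πi) is the imaginary constant i log(d)/π. The
  -- translation t contributes t/6, which is 2Φ̃(β).
  refine ⟨(β 0 0 / β 1 1 : ℚ), (β 0 1 / β 1 1 : ℚ), Real.log (β 1 1) / π,
    by exact_mod_cast div_pos ha hd, fun z => ?_⟩
  -- The positive diagonal of β gives e(σ, β) = 0, so `muPrim` is additive along the factorization,
  -- as Φ̃ is.
  have he : eulerCocycle z (Matrix.SpecialLinearGroup.map (algebraMap ℚ ℝ) (ofInt σ))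
      (Matrix.SpecialLinearGroup.map (algebraMap ℚ ℝ) β) = 0 := by
    have hco : denom (incl (ofInt σ * β)) z =
        ((β 1 1 : ℝ) : ℂ) * denom (incl (ofInt σ)) (incl β • z : ℍ) := by
      rw [incl_mul, denom_cocycle _ _ z.im_ne_zero, coe_incl_smul, hden, mul_comm]
    rw [eulerCocycle_eq, hco, logLow_real_mul hdR (denom_ne_zero _ _), hden, logLow_ofReal hdR]
    ring
  have hsmul : ((incl β • z : ℍ) : ℂ) =
      ((β 0 0 / β 1 1 : ℚ) : ℝ) * z + ((β 0 1 / β 1 1 : ℚ) : ℝ) := by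
    rw [coe_incl_smul, hden, num_incl]
    push_cast
    field_simp
  rw [muPrim_mul, he, muPrim_ofInt, muPrim_coe, hden, logLow_ofReal hdR, hsmul,
    rademacher_mul σ β ⟨hc, hd⟩, rademacherBorel, sign_pos hd, discLog, discLog]
  have hpi : (π : ℂ) ≠ 0 := by simp [Real.pi_ne_zero]
  generalize tailLog _ = A
  generalize tailLog _ = B
  simp only [SignType.coe_one]
  push_cast
  field_simp
  ring_nf
  rw [Complex.I_sq]
  ring

theorem tendsto_affine_comap_im {s : ℝ} (hs : 0 < s) (t : ℝ) :
    Filter.Tendsto (fun w : ℂ => s * w + t) (Filter.comap Complex.im Filter.atTop)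
      (Filter.comap Complex.im Filter.atTop) := by
  rw [Filter.tendsto_comap_iff]
  have : Complex.im ∘ (fun w : ℂ => s * w + t) = fun w => s * w.im := by
    ext w; simp
  rw [this]
  exact Filter.Tendsto.const_mul_atTop hs Filter.tendsto_comap

/-- The behaviour of `mu γ` and of its primitive at `i∞`. -/
theorem exists_asymptotics (γ : SL(2, ℚ)) (u : ℍ) : ∃ (a : ℂ) (l : ℝ),
    Filter.Tendsto (mu γ) atImInfty (nhds a) ∧
    MeasureTheory.IntegrableOn
      (fun t : ℝ => mu γ (ofComplex ((u : ℂ) + t * Complex.I)) - a) (Set.Ioi 0) ∧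
    Filter.Tendsto (fun t : ℝ => muPrim γ ((u : ℂ) + t * Complex.I) -
      a * ((u : ℂ) + t * Complex.I)) Filter.atTop
      (nhds (2 * (rademacher γ : ℂ) + l * Complex.I)) := by
  obtain ⟨s, t, l, hs, h⟩ := exists_muPrim_eq γ
  have him : ∀ z : ℍ, 0 < ((s : ℂ) * z + t).im := by
    intro z
    simpa using mul_pos hs z.im_pos
  have hmu : ∀ z : ℍ, mu γ z = (s - 1) / 6 +
      1 / (12 * π * Complex.I) * (s * tailLogDeriv (s * z + t) - tailLogDeriv z) := by
    intro z
    have hlin : HasDerivAt (fun w : ℂ => (s : ℂ) * w + t) s z := by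
      simpa only [mul_one] using! ((hasDerivAt_id (z : ℂ)).const_mul (s : ℂ)).add_const (t : ℂ)
    have h1 := HasDerivAt.comp (h₂ := tailLog) (z : ℂ) (hasDerivAt_tailLog (him z)) hlin
    have h2 := (h1.sub (hasDerivAt_tailLog z.2)).const_mul (1 / (12 * π * Complex.I))
    have h3 := (((hasDerivAt_id (z : ℂ)).const_mul ((s - 1) / 6 : ℂ)).const_add
      (2 * (rademacher γ : ℂ) + l * Complex.I)).add h2
    have h4 := (hasDerivAt_muPrim γ z).unique (h3.congr_of_eventuallyEq ?_)
    · rw [h4]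
      ring
    · filter_upwards [eventually_mem_upperHalfPlane z] with w hw
      exact h ⟨w, hw⟩
  refine ⟨(s - 1) / 6, l, ?_, ?_, ?_⟩
  · have hcoe : Filter.Tendsto (fun z : ℍ => (z : ℂ)) atImInfty
        (Filter.comap Complex.im Filter.atTop) :=
      Filter.tendsto_comap_iff.mpr Filter.tendsto_comap
    have h1 := ((tendsto_tailLogDeriv.comp (tendsto_affine_comap_im hs t)).comp hcoe).const_mul
      (s : ℂ)
    have h2 := ((h1.sub (tendsto_tailLogDeriv.comp hcoe)).const_mul
      (1 / (12 * π * Complex.I))).const_add ((s - 1) / 6 : ℂ)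
    simp only [mul_zero, sub_zero, add_zero] at h2
    exact h2.congr fun z => (hmu z).symm
  · have h1 := (integrableOn_tailLogDeriv (him u) hs).const_mul (s : ℂ)
    have h2 := integrableOn_tailLogDeriv u.im_pos one_pos
    refine MeasureTheory.IntegrableOn.congr_fun
      ((h1.sub h2).const_mul (1 / (12 * π * Complex.I))) (fun r hr => ?_) measurableSet_Ioi
    have hr' := add_mul_I_im_pos u (Set.mem_Ioi.mp hr).le
    have h3 := hmu ⟨_, hr'⟩
    simp only [ofComplex_apply_of_im_pos hr']
    rw [h3]
    have e1 : (s : ℂ) * ((u : ℂ) + r * Complex.I) + t = s * u + t + s * (r * Complex.I) := by ring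
    simp only [e1, Pi.sub_apply, Complex.ofReal_one, one_mul]
    ring
  · have hray : Filter.Tendsto (fun r : ℝ => (u : ℂ) + r * Complex.I) Filter.atTop
        (Filter.comap Complex.im Filter.atTop) := by
      simpa using tendsto_add_mul_I (u : ℂ) one_pos
    have h1 := tendsto_tailLog.comp ((tendsto_affine_comap_im hs t).comp hray)
    have h2 := ((h1.sub (tendsto_tailLog.comp hray)).const_mul
      (1 / (12 * π * Complex.I))).const_add (2 * (rademacher γ : ℂ) + l * Complex.I)
    simp only [mul_zero, sub_zero, add_zero] at h2
    refine h2.congr' ?_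
    filter_upwards [Filter.eventually_ge_atTop 0] with r hr
    have h3 := h ⟨_, add_mul_I_im_pos u hr⟩
    simp only at h3
    rw [h3]
    simp only [Function.comp_apply]
    ring

/-! ### The regularized Godbillon–Vey cocycle -/

theorem tauTilde_eq (z₀ : ℍ) {a b : Monomial} (hw : a.weight + b.weight = 2)
    (hγ : a.γ * b.γ = 1) {g h : ℍ → ℂ} (hg : a.f * (b.f ∣[b.weight] incl b.γ) = g)
    (hh : (a.f ∣[a.weight] incl a.γ) * b.f = h) :
    tauTilde z₀ a b = segIntegral g z₀ (a.γ • z₀) + (z₀ : ℂ) * a0 (g - h) -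
      cuspIntegral (remainder (g - h)) z₀ := by
  subst hg hh
  rw [tauTilde, if_pos ⟨hw, hγ⟩]

theorem one_slash_zero (γ : SL(2, ℚ)) : (1 : ℍ → ℂ) ∣[(0 : ℤ)] incl γ = 1 := by
  ext z
  simp [slash_incl_apply]

/-- The cocycle `GVTilde` in terms of a primitive of `mu γ₁ + mu γ₂ - mu (γ₁ γ₂)`. -/
theorem GVTilde_eq (z₀ : ℍ) (γ₁ γ₂ : SL(2, ℚ)) :
    GVTilde z₀ γ₁ γ₂ =
      segIntegral (mu γ₂ - mu (γ₁ * γ₂)) z₀ (incl γ₂⁻¹ • z₀) +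
        (z₀ : ℂ) * a0 (mu γ₁ + mu γ₂ - mu (γ₁ * γ₂)) -
        cuspIntegral (remainder (mu γ₁ + mu γ₂ - mu (γ₁ * γ₂))) z₀ := by
  have hmul : (γ₁ * γ₂)⁻¹ * γ₁ = γ₂⁻¹ := by group
  have hf : ((U (γ₁ * γ₂)⁻¹).mul (delta1 (U γ₁))).f = mu γ₂ - mu (γ₁ * γ₂) := by
    have : ((U (γ₁ * γ₂)⁻¹).mul (delta1 (U γ₁))).f =
        1 * ((mu γ₁⁻¹ * 1) ∣[(2 : ℤ)] incl ((γ₁ * γ₂)⁻¹)⁻¹) := rfl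
    rw [this, one_mul, mul_one, inv_inv, mu_slash, inv_mul_cancel_left]
  have hg : ((U (γ₁ * γ₂)⁻¹).mul (delta1 (U γ₁))).f *
      ((U γ₂).f ∣[(U γ₂).weight] incl (U γ₂).γ) = mu γ₂ - mu (γ₁ * γ₂) := by
    rw [hf, show (U γ₂).f ∣[(U γ₂).weight] incl (U γ₂).γ = 1 from one_slash_zero γ₂, mul_one]
  -- Slashing by γ₂⁻¹ gives `mu 1 - mu γ₁` after the two copies of `mu γ₂⁻¹` cancel, and `mu 1` is
  -- zero.
  have hh : (((U (γ₁ * γ₂)⁻¹).mul (delta1 (U γ₁))).f ∣[((U (γ₁ * γ₂)⁻¹).mul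
      (delta1 (U γ₁))).weight] incl ((U (γ₁ * γ₂)⁻¹).mul (delta1 (U γ₁))).γ) * (U γ₂).f =
        -mu γ₁ := by
    rw [hf]
    change (mu γ₂ - mu (γ₁ * γ₂)) ∣[(2 : ℤ)] incl ((γ₁ * γ₂)⁻¹ * γ₁) * 1 = _
    rw [hmul, mul_one, sub_eq_add_neg, SlashAction.add_slash, SlashAction.neg_slash, mu_slash,
      mu_slash, mul_inv_cancel, mul_inv_cancel_right, mu_one]
    abel
  rw [GVTilde, gvTilde, tauTilde_eq z₀ rfl (by simp [Monomial.mul, U, delta1]) hg hh,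
    sub_neg_eq_add]
  have e1 : mu γ₂ - mu (γ₁ * γ₂) + mu γ₁ = mu γ₁ + mu γ₂ - mu (γ₁ * γ₂) := by abel
  have e2 : ((U (γ₁ * γ₂)⁻¹).mul (delta1 (U γ₁))).γ = γ₂⁻¹ := hmul
  rw [e1, e2]
  rfl

/-- The term with `a0` offsets the linear part subtracted in the cusp integral, so that integral
contributes the regularized value at i∞ of a combination of primitives. The unknown l is harmless
since only the real part is used. -/
theorem exists_GVTilde_eq (z₀ z : ℍ) (γ₁ γ₂ : SL(2, ℚ)) : ∃ l : ℝ,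
    GVTilde z₀ γ₁ γ₂ = 2 * ((rademacher (γ₁ * γ₂) : ℂ) - rademacher γ₁ - rademacher γ₂) -
      2 * eulerCocycle z (Matrix.SpecialLinearGroup.map (algebraMap ℚ ℝ) γ₁)
        (Matrix.SpecialLinearGroup.map (algebraMap ℚ ℝ) γ₂) + l * Complex.I := by
  obtain ⟨a₁, l₁, ha₁, hi₁, hl₁⟩ := exists_asymptotics γ₁ z₀
  obtain ⟨a₂, l₂, ha₂, hi₂, hl₂⟩ := exists_asymptotics γ₂ z₀
  obtain ⟨a₃, l₃, ha₃, hi₃, hl₃⟩ := exists_asymptotics (γ₁ * γ₂) z₀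
  have ha0 : a0 (mu γ₁ + mu γ₂ - mu (γ₁ * γ₂)) = a₁ + a₂ - a₃ :=
    ((ha₁.add ha₂).sub ha₃).limUnder_eq
  have hseg := segIntegral_eq_sub (f := mu γ₂ - mu (γ₁ * γ₂))
    (fun w => (hasDerivAt_muPrim γ₂ w).sub (hasDerivAt_muPrim (γ₁ * γ₂) w)) z₀ (incl γ₂⁻¹ • z₀)
  have hcusp := cuspIntegral_eq_sub (f := remainder (mu γ₁ + mu γ₂ - mu (γ₁ * γ₂)))
    (F := fun w => muPrim γ₁ w + muPrim γ₂ w - muPrim (γ₁ * γ₂) w - (a₁ + a₂ - a₃) * w)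
    (m := 2 * (rademacher γ₁ : ℂ) + l₁ * Complex.I + (2 * (rademacher γ₂ : ℂ) + l₂ * Complex.I) -
      (2 * (rademacher (γ₁ * γ₂) : ℂ) + l₃ * Complex.I))
    (fun w => by
      rw [remainder, ha0]
      simpa only [mul_one] using! (((hasDerivAt_muPrim γ₁ w).add (hasDerivAt_muPrim γ₂ w)).sub
        (hasDerivAt_muPrim (γ₁ * γ₂) w)).sub
          ((hasDerivAt_id (w : ℂ)).const_mul (a₁ + a₂ - a₃))) z₀
    (by
      simp only [remainder, ha0]
      refine ((hi₁.add hi₂).sub hi₃).congr_fun (fun t _ => ?_) measurableSet_Ioi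
      simp only [Pi.add_apply, Pi.sub_apply]
      ring)
    (((hl₁.add hl₂).sub hl₃).congr fun t => by ring)
  refine ⟨l₃ - l₁ - l₂, ?_⟩
  rw [GVTilde_eq, hseg, hcusp, ha0]
  have h1 := muPrim_mul γ₁ γ₂ z₀
  -- After the terms at z₀ cancel, what remains is `muPrim γ₁` at z₀ and `muPrim γ₂ - muPrim (γ₁ *
  -- γ₂)` at γ₂⁻¹z₀; this relation sums them to −2e.
  have h2 := muPrim_mul γ₁ γ₂ (incl γ₂⁻¹ • z₀)
  rw [← mul_smul, ← incl_mul, mul_inv_cancel, incl_one, one_smul,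
    eulerCocycle_const _ z] at h2
  rw [eulerCocycle_const _ z] at h1
  simp only [Pi.sub_apply]
  push_cast
  linear_combination -h2

end Transgression

end

/-! ### Existence and uniqueness -/

theorem mainTheorem1 (z₀ z : UpperHalfPlane) :
    (∀ γ₁ γ₂ : Matrix.SpecialLinearGroup (Fin 2) ℚ,
      (1 / 2 : ℂ) * ((Transgression.GVTilde z₀ γ₁ γ₂).re : ℂ) +
          Transgression.eulerCocycle z
            (Matrix.SpecialLinearGroup.map (algebraMap ℚ ℝ) γ₁)
            (Matrix.SpecialLinearGroup.map (algebraMap ℚ ℝ) γ₂) =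
        (Transgression.rademacher (γ₁ * γ₂) : ℂ) - (Transgression.rademacher γ₁ : ℂ)
          - (Transgression.rademacher γ₂ : ℂ)) ∧
    ∀ F : Matrix.SpecialLinearGroup (Fin 2) ℚ → ℝ,
      (∀ γ₁ γ₂ : Matrix.SpecialLinearGroup (Fin 2) ℚ,
        (1 / 2 : ℂ) * ((Transgression.GVTilde z₀ γ₁ γ₂).re : ℂ) +
            Transgression.eulerCocycle z
              (Matrix.SpecialLinearGroup.map (algebraMap ℚ ℝ) γ₁)
              (Matrix.SpecialLinearGroup.map (algebraMap ℚ ℝ) γ₂) =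
          (F (γ₁ * γ₂) : ℂ) - (F γ₁ : ℂ) - (F γ₂ : ℂ)) →
      ∀ γ : Matrix.SpecialLinearGroup (Fin 2) ℚ, F γ = (Transgression.rademacher γ : ℝ) := by
  have main : ∀ γ₁ γ₂ : Matrix.SpecialLinearGroup (Fin 2) ℚ,
      (1 / 2 : ℂ) * ((Transgression.GVTilde z₀ γ₁ γ₂).re : ℂ) +
          Transgression.eulerCocycle z
            (Matrix.SpecialLinearGroup.map (algebraMap ℚ ℝ) γ₁)
            (Matrix.SpecialLinearGroup.map (algebraMap ℚ ℝ) γ₂) =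
        (Transgression.rademacher (γ₁ * γ₂) : ℂ) - (Transgression.rademacher γ₁ : ℂ)
          - (Transgression.rademacher γ₂ : ℂ) := by
    intro γ₁ γ₂
    obtain ⟨l, hl⟩ := Transgression.exists_GVTilde_eq z₀ z γ₁ γ₂
    -- Since e is an integer it passes unchanged through the real part, which removes the imaginary
    -- constant.
    obtain ⟨n, hn⟩ := Transgression.exists_int_eulerCocycle z γ₁ γ₂
    rw [hn] at hl ⊢
    have hre : (Transgression.GVTilde z₀ γ₁ γ₂).re =
        ((2 * (Transgression.rademacher (γ₁ * γ₂) - Transgression.rademacher γ₁ -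
          Transgression.rademacher γ₂) - 2 * n : ℚ) : ℝ) := by
      have e : Transgression.GVTilde z₀ γ₁ γ₂ =
          (((2 * (Transgression.rademacher (γ₁ * γ₂) - Transgression.rademacher γ₁ -
            Transgression.rademacher γ₂) - 2 * n : ℚ) : ℝ) : ℂ) + l * Complex.I := by
        rw [hl]
        push_cast
        ring
      rw [e, Complex.add_re, Complex.ofReal_re, Complex.re_ofReal_mul, Complex.I_re, mul_zero,
        add_zero]
    rw [hre]
    push_cast
    ring
  refine ⟨main, fun F hF γ => ?_⟩
  -- Both functions have the same coboundary, so their difference is an additive character.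
  have hadd : ∀ x y, F (x * y) - (Transgression.rademacher (x * y) : ℝ) =
      (F x - (Transgression.rademacher x : ℝ)) + (F y - (Transgression.rademacher y : ℝ)) := by
    intro x y
    have h : ((F (x * y) - F x - F y : ℝ) : ℂ) =
        (((Transgression.rademacher (x * y) : ℝ) - (Transgression.rademacher x : ℝ) -
          (Transgression.rademacher y : ℝ) : ℝ) : ℂ) := by
      push_cast
      rw [← hF, main]
    have h' := Complex.ofReal_injective h
    linarith
  exact sub_eq_zero.mp (Transgression.eq_zero_of_map_mul
    (f := fun x => F x - (Transgression.rademacher x : ℝ)) hadd γ)
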